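/- **Setting.** Let $\mathcal F(n,m)$ be the set of planar binary forests with $n$ roots and $m$ leaves, and let $\mathcal{SF}$ be the category of symmetric forests: its objects are the positive integers, $\mathcal{SF}(n,m)=\mathcal F(n,m)\times S_m$, and in a composition $p\circ q$ of $p\in\mathcal{SF}(m,k)$ with $q=(q_0,\tau)\in\mathcal{SF}(n,m)$ the $\tau(i)$-th root of $p$ is attached to the $i$-th leaf of $q_0$. A symmetric tree with $n$ leaves is an element of $\mathcal{SF}(1,n)$; it is affine if its permutation is a cyclic rotation (an element of $\mathbf Z/n\mathbf Z\subset S_n$). Thompson's group $V$ is the group of classes $\frac{t}{s}$ of pairs $(t,s)$ of symmetric trees with the same number of leaves, modulo the equivalence relation generated by $(t,s)\sim(p\circ t,p\circ s)$, with $\frac ts\cdot\frac sr=\frac tr$. Thompson's group $T\subset V$ is the subgroup of all fractions of affine trees. A pair $(t,s)$ of symmetric trees with $n$ leaves is reduced if $\frac ts$ is not represented by any pair of symmetric trees with fewer than $n$ leaves. Let $\mathfrak H=\ell^2(\mathbb F_2)$, where $\mathbb F_2$ is the free group on $a,b$, with its canonical orthonormal basis $(\delta_g)$; identify $\mathfrak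 H^{\otimes n}$ with $\ell^2(\mathbb F_2^n)$. For $0\le\alpha\le1$ let $R_\alpha:\mathfrak H\to\mathfrak H\otimes\mathfrak H$ be the isometry with $$R_\alpha\delta_e=\alpha\,\delta_{e,e}+\sqrt{1-\alpha^2}\,\delta_{a,b},\qquad R_\alpha\delta_g=\delta_{ag,bg}\quad(g\ne e).$$ Let $\Phi_\alpha$ be the functor from $\mathcal{SF}$ to Hilbert spaces and isometries with $\Phi_\alpha(n)=\mathfrak H^{\otimes n}$ that maps the forest with $n$ roots whose $i$-th tree has two leaves and whose other trees are trivial to $\mathrm{id}^{\otimes i-1}\otimes R_\alpha\otimes\mathrm{id}^{\otimes n-i}$, and a permutation $\tau$ to the unitary that moves the $i$-th tensor factor to position $\tau(i)$. Let $\mathscr H_\alpha$ be the completion of the space of classes of pairs $(t,\xi)$, with $t$ a symmetric tree with $n$ leaves and $\xi\in\mathfrak H^{\otimes n}$, modulo the relation generated by $(t,\xi)\sim(p\circ t,\Phi_\alpha(p)\xi)$, with $\langle(t,\xi),(t,\eta)\rangle=\langle\xi,\eta\rangle$. Let $\pi_\alpha:V\to\mathcal U(\mathscr H_\alpha)$ be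 the unitary representation with $\pi_\alpha(\frac ts)(s,\xi)=(t,\xi)$, let $\delta_e\in\mathfrak H\subset\mathscr H_\alpha$ (pairs with the trivial tree), and put $\varphi_\alpha(g)=\langle\pi_\alpha(g)\delta_e,\delta_e\rangle$ for $g\in V$. **Theorem.** 1. For every $0\le\alpha\le1$ the function $\varphi_\alpha$ is positive definite on $V$. 2. Every $g\in T$ is of the form $g=\frac ts$ for a reduced pair $(t,s)$ of affine trees. If $(t,s)$ is any reduced pair of affine trees with $n$ leaves, then for every $0\le\alpha\le1$ $$\varphi_\alpha\left(\frac ts\right)=\alpha^{2n-2}$$ (with $0^0=1$). 3. For every $0\le\alpha<1$ the restriction of $\varphi_\alpha$ to $T$ vanishes at infinity (for every $\varepsilon>0$, $|\varphi_\alpha(g)|<\varepsilon$ for all but finitely many $g\in T$). 4. For every $g\in T$, $\varphi_\alpha(g)\to1$ as $\alpha\to1$, $\alpha<1$. 5. $T$ has the Haagerup property: it is countable, and there is a sequence of positive definite functions on $T$ that vanish at infinity on $T$ and converge pointwise to $1$. -/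

import Mathlib

namespace Thompson

/-- Finite planar rooted binary trees whose leaves carry labels in `X`. -/
inductive LTree (X : Type) : Type
  | leaf (x : X) : LTree X
  | node (l r : LTree X) : LTree X

namespace LTree

/-- Substitution: `t.bind p` glues the tree `p x` on top of every leaf of `t` labelled `x`. -/
def bind {X Y : Type} : LTree X → (X → LTree Y) → LTree Y
  | leaf x, p => p x
  | node l r, p => node (l.bind p) (r.bind p)

/-- The list of the labels of the leaves, read from left to right. -/
def labels {X : Type} : LTree X → List X
  | leaf x => [x]
  | node l r => l.labels ++ r.labels

theorem bind_assoc {X Y Z : Type} (t : LTree X) (p : X → LTree Y) (q : Y → LTree Z) :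
    (t.bind p).bind q = t.bind fun x => (p x).bind q := by
  induction t with
  | leaf x => rfl
  | node l r hl hr => simp [bind, hl, hr]

theorem bind_leaf {X : Type} (t : LTree X) : t.bind leaf = t := by
  induction t with
  | leaf x => rfl
  | node l r hl hr => simp [bind, hl, hr]

theorem labels_bind {X Y : Type} (t : LTree X) (p : X → LTree Y) :
    (t.bind p).labels = t.labels.flatMap fun x => (p x).labels := by
  induction t with
  | leaf x => simp [bind, labels]
  | node l r hl hr => simp [bind, labels, hl, hr]

theorem eq_of_bind_eq {X Y : Type} {t : LTree X} {p q : X → LTree Y}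
    (h : t.bind p = t.bind q) : ∀ x ∈ t.labels, p x = q x := by
  induction t with
  | leaf x => simpa [bind, labels] using h
  | node l r hl hr =>
    simp only [bind, node.injEq] at h
    intro x hx
    rcases List.mem_append.1 hx with hx | hx
    · exact hl h.1 x hx
    · exact hr h.2 x hx

theorem bind_congr {X Y : Type} (t : LTree X) (p q : X → LTree Y)
    (h : ∀ x ∈ t.labels, p x = q x) : t.bind p = t.bind q := by
  induction t with
  | leaf x => exact h x (by simp [labels])
  | node l r hl hr =>
    simp only [bind, node.injEq]
    exact ⟨hl fun x hx => h x (by simp [labels, hx]), hr fun x hx => h x (by simp [labels, hx])⟩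

theorem labels_ne_nil {X : Type} (t : LTree X) : t.labels ≠ [] := by
  induction t with
  | leaf x => simp [labels]
  | node l r hl hr => simp [labels, hl]

/-- There are trees that can be obtained from every tree with at most `d + 1` leaves. -/
theorem exists_full (d : ℕ) : ∃ u : LTree Unit, ∀ {X : Type} (t : LTree X),
    t.labels.length ≤ d + 1 → t.labels.Nodup → ∃ p : X → LTree Unit, t.bind p = u := by
  induction d with
  | zero =>
    refine ⟨leaf (), fun t ht _ => ?_⟩
    cases t with
    | leaf x => exact ⟨fun _ => leaf (), rfl⟩
    | node l r =>
      have := List.length_pos_iff.2 l.labels_ne_nil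
      have := List.length_pos_iff.2 r.labels_ne_nil
      simp [labels] at ht
      omega
  | succ d ih =>
    obtain ⟨u, hu⟩ := ih
    refine ⟨node u u, fun {X} t ht hn => ?_⟩
    cases t with
    | leaf x => exact ⟨fun _ => node u u, rfl⟩
    | node l r =>
      have := List.length_pos_iff.2 l.labels_ne_nil
      have := List.length_pos_iff.2 r.labels_ne_nil
      simp only [labels, List.length_append] at ht
      simp only [labels, List.nodup_append'] at hn
      obtain ⟨p, hp⟩ := hu l (by omega) hn.1
      obtain ⟨q, hq⟩ := hu r (by omega) hn.2.1
      classical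
      refine ⟨fun x => if x ∈ l.labels then p x else q x, ?_⟩
      rw [bind, node.injEq]
      refine ⟨(bind_congr l _ p fun x hx => by simp [hx]).trans hp,
        (bind_congr r _ q fun x hx => ?_).trans hq⟩
      have : x ∉ l.labels := fun h => hn.2.2 h hx
      simp [this]

/-- A tree can be relabelled so that its labels, from left to right, form a given list. -/
theorem exists_relabel {Y : Type} {X : Type} (t : LTree X) (L : List Y)
    (h : L.length = t.labels.length) :
    ∃ u : LTree Y, u.labels = L ∧ u.bind (fun _ => leaf ()) = t.bind fun _ => leaf () := by
  induction t generalizing L with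
  | leaf x =>
    obtain ⟨y, rfl⟩ := List.length_eq_one_iff.1 (by simpa [labels] using h)
    exact ⟨leaf y, rfl, rfl⟩
  | node l r hl hr =>
    simp only [labels, List.length_append] at h
    obtain ⟨u, hu, hu'⟩ := hl (L.take l.labels.length) (by simp; omega)
    obtain ⟨v, hv, hv'⟩ := hr (L.drop l.labels.length) (by simp; omega)
    exact ⟨node u v, by simp [labels, hu, hv], by simp [bind, hu', hv']⟩

/-- If the shape of `u` is obtained by gluing trees on `t`, so is `u` itself. -/
theorem exists_bind_eq {X Y : Type} (t : LTree X) (hn : t.labels.Nodup) (u : LTree Y)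
    (h : ∃ p : X → LTree Unit, t.bind p = u.bind fun _ => leaf ()) :
    ∃ p : X → LTree Y, t.bind p = u := by
  induction t generalizing u with
  | leaf x => exact ⟨fun _ => u, rfl⟩
  | node l r hl hr =>
    obtain ⟨p, hp⟩ := h
    cases u with
    | leaf y => simp [bind] at hp
    | node a b =>
      simp only [bind, node.injEq] at hp
      simp only [labels, List.nodup_append'] at hn
      obtain ⟨p₁, h₁⟩ := hl hn.1 a ⟨p, hp.1⟩
      obtain ⟨p₂, h₂⟩ := hr hn.2.1 b ⟨p, hp.2⟩
      classical
      refine ⟨fun x => if x ∈ l.labels then p₁ x else p₂ x, ?_⟩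
      rw [bind, node.injEq]
      refine ⟨(bind_congr l _ p₁ fun x hx => by simp [hx]).trans h₁,
        (bind_congr r _ p₂ fun x hx => ?_).trans h₂⟩
      have : x ∉ l.labels := fun h => hn.2.2 h hx
      simp [this]

end LTree

open LTree

/-- Symmetric forests with `n` roots and `m` leaves, i.e. the morphisms from `n` to `m` in the
category of symmetric forests. A pair `(p, τ)`, with `p` a planar binary forest with `n` roots and
`m` leaves and `τ` a permutation of the `m` leaves, is encoded by writing the label `τ i` on the
`i`-th leaf of `p` (counted from left to right): the list of all labels is the permutation `τ` in
one-line notation. The number `τ i` is the position to which the strand starting at the `i`-th leaf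
goes. -/
@[ext]
structure SForest (n m : ℕ) where
  tree : Fin n → LTree (Fin m)
  perm : ((List.finRange n).flatMap fun j => (tree j).labels).Perm (List.finRange m)

namespace SForest

/-- The permutation of a symmetric forest, as the list `τ 0, τ 1, …, τ (m - 1)`. -/
def leafLabels {n m : ℕ} (f : SForest n m) : List (Fin m) :=
  (List.finRange n).flatMap fun j => (f.tree j).labels

/-- The identity: `n` trivial trees and the trivial permutation. -/
def id (n : ℕ) : SForest n n := ⟨fun j => leaf j, by simp [labels]⟩

/-- The composition `p ∘ q`: `p` is stacked on top of `q`, so the root `τ i` of `p` is attached to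
the `i`-th leaf of `q`, where `τ` is the permutation of `q`. -/
def comp {n m k : ℕ} (p : SForest m k) (q : SForest n m) : SForest n k where
  tree j := (q.tree j).bind p.tree
  perm := by
    simp only [labels_bind]
    rw [← List.flatMap_assoc]
    exact (q.perm.flatMap_right _).trans p.perm

theorem comp_assoc {n m k l : ℕ} (p : SForest k l) (q : SForest m k) (r : SForest n m) :
    (p.comp q).comp r = p.comp (q.comp r) := by
  ext j : 2
  exact (bind_assoc _ _ _).symm

theorem id_comp {n m : ℕ} (p : SForest n m) : (id m).comp p = p := by
  ext j : 2
  exact bind_leaf _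

theorem comp_id {n m : ℕ} (p : SForest n m) : p.comp (id n) = p := rfl

theorem leafLabels_comp {n m k : ℕ} (p : SForest m k) (q : SForest n m) :
    (p.comp q).leafLabels = q.leafLabels.flatMap fun x => (p.tree x).labels := by
  simp [leafLabels, comp, labels_bind, List.flatMap_assoc]

theorem leafLabels_one {n : ℕ} (t : SForest 1 n) : t.leafLabels = (t.tree 0).labels := by
  simp [leafLabels, List.finRange_succ]

theorem comp_left_cancel {m k : ℕ} (t : SForest 1 m) {p q : SForest m k}
    (h : p.comp t = q.comp t) : p = q := by
  have h0 : (t.tree 0).bind p.tree = (t.tree 0).bind q.tree :=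
    congrArg (fun f : SForest 1 k => f.tree 0) h
  ext x : 2
  refine eq_of_bind_eq h0 x ?_
  rw [← leafLabels_one]
  exact t.perm.mem_iff.2 (List.mem_finRange x)

theorem exists_comp_eq {m k : ℕ} (t : SForest 1 m) (u : SForest 1 k)
    (h : ∃ p : Fin m → LTree (Fin k), (t.tree 0).bind p = u.tree 0) :
    ∃ p : SForest m k, p.comp t = u := by
  obtain ⟨p, hp⟩ := h
  refine ⟨⟨p, ?_⟩, ?_⟩
  · refine (t.perm.symm.flatMap_right _).trans ?_
    change (t.leafLabels.flatMap _).Perm _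
    rw [leafLabels_one, ← labels_bind, hp, ← leafLabels_one]
    exact u.perm
  · ext j : 2
    rw [Subsingleton.elim j 0]
    exact hp

/-- Any two symmetric trees have a common expansion, whose leaves can be taken to be numbered
in order. -/
theorem exists_common {m k : ℕ} (t : SForest 1 m) (s : SForest 1 k) :
    ∃ (N : ℕ) (u : SForest 1 N) (p : SForest m N) (q : SForest k N),
      p.comp t = u ∧ q.comp s = u ∧ u.leafLabels = List.finRange N := by
  obtain ⟨u₀, hu₀⟩ := exists_full (m + k)
  have len : ∀ {i : ℕ} (a : SForest 1 i), (a.tree 0).labels.length = i := fun a => by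
    rw [← leafLabels_one]; exact a.perm.length_eq.trans List.length_finRange
  have nod : ∀ {i : ℕ} (a : SForest 1 i), (a.tree 0).labels.Nodup := fun a => by
    rw [← leafLabels_one]; exact a.perm.nodup_iff.2 (List.nodup_finRange _)
  obtain ⟨v, hv, hv'⟩ := exists_relabel u₀ (List.finRange u₀.labels.length) (by simp)
  have hu₀' : (u₀.bind fun _ => leaf ()) = u₀ := bind_leaf u₀
  let u : SForest 1 u₀.labels.length :=
    ⟨fun _ => v, by simp [List.finRange_succ, hv]⟩
  have hu : u.leafLabels = List.finRange _ := by rw [leafLabels_one]; exact hv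
  obtain ⟨p, hp⟩ := exists_comp_eq t u (exists_bind_eq _ (nod t) _ (by
    obtain ⟨p, hp⟩ := hu₀ (t.tree 0) (by rw [len]; omega) (nod t)
    exact ⟨p, hp.trans (hu₀'.symm.trans hv'.symm)⟩))
  obtain ⟨q, hq⟩ := exists_comp_eq s u (exists_bind_eq _ (nod s) _ (by
    obtain ⟨p, hp⟩ := hu₀ (s.tree 0) (by rw [len]; omega) (nod s)
    exact ⟨p, hp.trans (hu₀'.symm.trans hv'.symm)⟩))
  exact ⟨_, u, p, q, hp, hq, hu⟩

/-- A symmetric forest is affine if its permutation is a cyclic rotation. -/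
def IsAffine {n m : ℕ} (f : SForest n m) : Prop := f.leafLabels.IsRotated (List.finRange m)

end SForest

/-- Symmetric trees `(t, τ)` with any number `n` of leaves. -/
structure STree where
  n : ℕ
  forest : SForest 1 n

/-- `t ≤ s` if `s = p ∘ t` for some symmetric forest `p`. -/
instance : Preorder STree where
  le t s := ∃ p : SForest t.n s.n, p.comp t.forest = s.forest
  le_refl t := ⟨SForest.id _, SForest.id_comp _⟩
  le_trans t s u := fun ⟨p, hp⟩ ⟨q, hq⟩ => ⟨q.comp p, by rw [SForest.comp_assoc, hp, hq]⟩

instance : IsDirectedOrder STree where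
  directed t s := by
    obtain ⟨N, u, p, q, hp, hq, -⟩ := SForest.exists_common t.forest s.forest
    exact ⟨⟨N, u⟩, ⟨p, hp⟩, ⟨q, hq⟩⟩

instance : Nonempty STree := ⟨⟨1, SForest.id 1⟩⟩

namespace STree

/-- The (unique) symmetric forest `p` with `s = p ∘ t`. -/
noncomputable def growth {t s : STree} (h : t ≤ s) : SForest t.n s.n := h.choose

theorem growth_comp {t s : STree} (h : t ≤ s) : (growth h).comp t.forest = s.forest :=
  h.choose_spec

theorem growth_eq {t s : STree} (h : t ≤ s) (p : SForest t.n s.n)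
    (hp : p.comp t.forest = s.forest) : growth h = p :=
  SForest.comp_left_cancel t.forest ((growth_comp h).trans hp.symm)

theorem growth_self (t : STree) (h : t ≤ t) : growth h = SForest.id _ :=
  growth_eq h _ (SForest.id_comp _)

theorem growth_trans {t s u : STree} (h : t ≤ s) (h' : s ≤ u) (h'' : t ≤ u) :
    growth h'' = (growth h').comp (growth h) :=
  growth_eq h'' _ (by rw [SForest.comp_assoc, growth_comp, growth_comp])

end STree

/-- Functions as a structure (the direct limits of Mathlib take bundled maps). -/
structure Fn (A B : Type) where
  toFun : A → B

instance (A B : Type) : FunLike (Fn A B) A B := ⟨Fn.toFun, fun ⟨_⟩ ⟨_⟩ h => congrArg Fn.mk h⟩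

/-- The map `x ↦ p ∘ x`, where `s = p ∘ t`. -/
noncomputable def treeMap (t s : STree) (h : t ≤ s) : Fn (SForest 1 t.n) (SForest 1 s.n) :=
  ⟨(STree.growth h).comp⟩

theorem treeMap_apply {t s : STree} (h : t ≤ s) (x : SForest 1 t.n) :
    treeMap t s h x = (STree.growth h).comp x := rfl

instance : DirectedSystem (fun t : STree => SForest 1 t.n) (treeMap · · ·) where
  map_self t x := by simp [treeMap_apply, STree.growth_self, SForest.id_comp]
  map_map k j i hij hjk x := by
    simp [treeMap_apply, STree.growth_trans hij hjk (hij.trans hjk), SForest.comp_assoc]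

section Action

variable {F : ℕ → Type} (φ : ∀ {n m}, SForest n m → F n → F m)
  {M : ∀ ⦃t s : STree⦄, t ≤ s → Type}
  [∀ ⦃t s : STree⦄ (h : t ≤ s), FunLike (M h) (F t.n) (F s.n)]
  (f : ∀ (t s : STree) (h : t ≤ s), M h)
  [DirectedSystem (fun t : STree => F t.n) (f · · ·)]

theorem mk_growth (hf : ∀ t s h x, f t s h x = φ (STree.growth h) x) {n m : ℕ} (p : SForest n m) (t : SForest 1 n) (x : F n) :
    (⟦⟨⟨m, p.comp t⟩, φ p x⟩⟧ : DirectLimit (fun t : STree => F t.n) f) = ⟦⟨⟨n, t⟩, x⟩⟧ := by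
  have h : (⟨n, t⟩ : STree) ≤ ⟨m, p.comp t⟩ := ⟨p, rfl⟩
  have h' : STree.growth h = p := STree.growth_eq h p rfl
  have := DirectLimit.mk_apply (F := fun t : STree => F t.n) (f := f)
    (⟨n, t⟩ : STree) ⟨m, p.comp t⟩ x h
  rw [hf, h'] at this
  exact this

/-- The map `((s, t), (s, x)) ↦ (t, x)`. -/
noncomputable def transport (hf : ∀ t s h x, f t s h x = φ (STree.growth h) x) :
    DirectLimit (fun t : STree => SForest 1 t.n) treeMap →
    DirectLimit (fun t : STree => F t.n) f → DirectLimit (fun t : STree => F t.n) f :=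
  DirectLimit.lift₂ treeMap f (fun s t x => ⟦⟨⟨s.n, t⟩, x⟩⟧) fun s s' h t x => by
    rw [hf, treeMap_apply]
    exact (mk_growth φ f hf (STree.growth h) t x).symm

theorem transport_mk (hf : ∀ t s h x, f t s h x = φ (STree.growth h) x) {n : ℕ} (s t : SForest 1 n) (x : F n) :
    transport φ f hf ⟦⟨⟨n, s⟩, t⟩⟧ ⟦⟨⟨n, s⟩, x⟩⟧ = ⟦⟨⟨n, t⟩, x⟩⟧ :=
  DirectLimit.lift₂_def (F₁ := fun t : STree => SForest 1 t.n) (F₂ := fun t : STree => F t.n)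
    treeMap f _ _ ⟨n, s⟩ t x

end Action

/-- Thompson's group `V`, as the group of fractions of the category of symmetric forests: the pairs
`(t, s)` of symmetric trees with the same number of leaves, modulo the equivalence relation
generated by `(t, s) ∼ (p ∘ t, p ∘ s)`. In the direct limit, `s` is an element of the set of
symmetric trees with as many leaves as the index `t`. -/
def ThompsonV : Type := DirectLimit (fun t : STree => SForest 1 t.n) treeMap

namespace ThompsonV

/-- The class `t / s` of the pair `(t, s)`. -/
noncomputable def frac {n : ℕ} (t s : SForest 1 n) : ThompsonV := (⟦⟨⟨n, t⟩, s⟩⟧ : DirectLimit _ treeMap)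

theorem frac_comp {n m : ℕ} (p : SForest n m) (t s : SForest 1 n) :
    frac (p.comp t) (p.comp s) = frac t s :=
  mk_growth SForest.comp treeMap (fun _ _ _ _ => rfl) p t s

theorem exists_frac (g : ThompsonV) : ∃ (n : ℕ) (t s : SForest 1 n), g = frac t s := by
  obtain ⟨⟨n, t⟩, s, h⟩ := DirectLimit.exists_eq_mk treeMap g
  exact ⟨n, t, s, h⟩

/-- Two elements can be written as `t / s` and `s / r`. -/
theorem exists_frac₂ (g h : ThompsonV) :
    ∃ (n : ℕ) (t s r : SForest 1 n), g = frac t s ∧ h = frac s r := by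
  obtain ⟨n, t, s, rfl⟩ := exists_frac g
  obtain ⟨m, s', r, rfl⟩ := exists_frac h
  obtain ⟨N, u, p, q, hp, hq, -⟩ := SForest.exists_common s s'
  refine ⟨N, p.comp t, u, q.comp r, ?_, ?_⟩
  · rw [← hp, frac_comp]
  · rw [← hq, frac_comp]

noncomputable instance : One ThompsonV := ⟨frac (SForest.id 1) (SForest.id 1)⟩

noncomputable instance : Inv ThompsonV :=
  ⟨DirectLimit.lift treeMap (fun t s => frac s t.forest) fun t t' h s => by
    rw [treeMap_apply, ← STree.growth_comp h, frac_comp]⟩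

noncomputable instance : Mul ThompsonV :=
  ⟨fun g h => transport SForest.comp treeMap (fun _ _ _ _ => rfl) (g⁻¹ : ThompsonV) h⟩

theorem inv_frac {n : ℕ} (t s : SForest 1 n) : (frac t s)⁻¹ = frac s t := rfl

theorem frac_mul {n : ℕ} (t s r : SForest 1 n) : frac t s * frac s r = frac t r :=
  transport_mk SForest.comp treeMap (fun _ _ _ _ => rfl) s t r

theorem frac_self {n : ℕ} (t : SForest 1 n) : frac t t = 1 := by
  have := frac_comp t (SForest.id 1) (SForest.id 1)
  rwa [SForest.comp_id] at this

/-- The group law: `(t / s) * (s / r) = t / r`, with inverse `(t / s)⁻¹ = s / t`. -/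
noncomputable instance : Group ThompsonV :=
  Group.ofLeftAxioms
    (fun g h k => by
      obtain ⟨n, t, s, r, rfl, rfl⟩ := exists_frac₂ g h
      obtain ⟨m, r', v, rfl⟩ := exists_frac k
      obtain ⟨N, u, p, q, hp, hq, -⟩ := SForest.exists_common r r'
      rw [← frac_comp p t s, ← frac_comp p s r, ← frac_comp q r' v, hp, hq]
      simp only [frac_mul])
    (fun g => by
      obtain ⟨n, t, s, rfl⟩ := exists_frac g
      rw [← frac_self t, frac_mul])
    (fun g => by
      obtain ⟨n, t, s, rfl⟩ := exists_frac g
      rw [inv_frac, frac_mul, frac_self])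

/-- A pair of symmetric trees is reduced if no pair with fewer leaves represents the same element. -/
def IsReduced {n : ℕ} (t s : SForest 1 n) : Prop :=
  ∀ (m : ℕ) (t' s' : SForest 1 m), m < n → frac t' s' ≠ frac t s

end ThompsonV

theorem SForest.isAffine_comp {n m : ℕ} {p : SForest n m} {t s : SForest 1 n}
    (ht : t.IsAffine) (hs : s.IsAffine) (h : (p.comp s).IsAffine) : (p.comp t).IsAffine := by
  have key : ∀ (L : List (Fin n)) (k : ℕ), ((L.rotate k).flatMap fun x => (p.tree x).labels).IsRotated
      (L.flatMap fun x => (p.tree x).labels) := by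
    intro L k
    rw [List.rotate_eq_drop_append_take_mod]
    conv_rhs => rw [← List.take_append_drop (k % L.length) L]
    simp only [List.flatMap_append]
    exact List.isRotated_append
  rw [IsAffine, leafLabels_comp] at h ⊢
  obtain ⟨k, hk⟩ := ht.trans hs.symm
  exact .trans (by rw [← hk]; exact (key _ k).symm) h

/-- Thompson's group `T`: the fractions of affine trees. -/
def ThompsonT : Subgroup ThompsonV where
  carrier := {g | ∃ (n : ℕ) (t s : SForest 1 n), t.IsAffine ∧ s.IsAffine ∧ g = .frac t s}
  one_mem' := ⟨1, SForest.id 1, SForest.id 1, .refl _, .refl _, rfl⟩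
  inv_mem' := by
    rintro _ ⟨n, t, s, ht, hs, rfl⟩
    exact ⟨n, s, t, hs, ht, rfl⟩
  mul_mem' := by
    rintro _ _ ⟨n, t, s, ht, hs, rfl⟩ ⟨m, s', r, hs', hr, rfl⟩
    obtain ⟨N, u, p, q, hp, hq, hu⟩ := SForest.exists_common s s'
    have hu' : u.IsAffine := by rw [SForest.IsAffine, hu]
    refine ⟨N, p.comp t, q.comp r, SForest.isAffine_comp ht hs (hp ▸ hu'),
      SForest.isAffine_comp hr hs' (hq ▸ hu'), ?_⟩
    rw [← ThompsonV.frac_comp p t s, ← ThompsonV.frac_comp q s' r, hp, hq, ThompsonV.frac_mul]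

/-- The Hilbert space `ℓ²(A)`. -/
abbrev L2 (A : Type) : Type := lp (fun _ : A => ℂ) 2

namespace L2

open scoped InnerProductSpace

open Classical in
/-- The canonical orthonormal basis. -/
noncomputable def δ {A : Type} (a : A) : L2 A := lp.single 2 a (1 : ℂ)

theorem inner_δ {A : Type} (a : A) (v : L2 A) : ⟪δ a, v⟫_ℂ = v a := by
  classical
  simp [δ, lp.inner_single_left]

theorem δ_apply {A : Type} [DecidableEq A] (a b : A) : (δ a : L2 A) b = if b = a then 1 else 0 := by
  classical
  simp [δ, Pi.single_apply]

theorem orthonormal_δ {A : Type} : Orthonormal ℂ (δ : A → L2 A) := by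
  classical
  rw [orthonormal_iff_ite]
  intro a b
  rw [inner_δ, δ_apply]

theorem ext_inner {A : Type} {E : Type*} [NormedAddCommGroup E] [InnerProductSpace ℂ E]
    {S T : L2 A →L[ℂ] E} (h : ∀ a, S (δ a) = T (δ a)) : S = T := by
  classical
  ext v
  have hv := lp.hasSum_single (E := fun _ : A => ℂ) (p := 2) (by simp) v
  refine (hv.mapL S).unique ?_
  convert hv.mapL T using 2 with a
  have : lp.single (E := fun _ : A => ℂ) 2 a (v a) = v a • δ a := by
    rw [δ, ← lp.single_smul]; simp
  rw [this, map_smul, map_smul, h]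

theorem summable_sq {A : Type} (v : L2 A) : Summable fun a => ‖v a‖ ^ 2 := by
  have := (memℓp_gen_iff (p := 2) (by simp)).1 (lp.memℓp v)
  simpa using this

theorem memℓp_of_summable {A : Type} {v : A → ℂ} (h : Summable fun a => ‖v a‖ ^ 2) :
    Memℓp v 2 := (memℓp_gen_iff (p := 2) (by simp)).2 (by simpa using h)

theorem summable_norm_inner {A : Type} (v w : L2 A) : Summable fun a => ‖⟪v a, w a⟫_ℂ‖ := by
  refine .of_nonneg_of_le (fun _ => norm_nonneg _) (fun a => ?_)
    ((summable_sq v).add (summable_sq w))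
  refine (norm_inner_le_norm _ _).trans ?_
  nlinarith [sq_nonneg (‖v a‖ - ‖w a‖), sq_nonneg ‖v a‖, sq_nonneg ‖w a‖]

theorem tsum_pi : ∀ {n : ℕ} {B : Fin n → Type} (f : ∀ j, B j → ℂ),
    (∀ j, Summable fun b => ‖f j b‖) →
    (Summable fun b : ∀ j, B j => ‖∏ j, f j (b j)‖) ∧
      ∑' b : ∀ j, B j, ∏ j, f j (b j) = ∏ j, ∑' b, f j b := by
  intro n
  induction n with
  | zero => intro B f _; simp [summable_of_hasFiniteSupport (Set.toFinite _)]
  | succ n ih =>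
    intro B f hf
    obtain ⟨h₁, h₂⟩ := ih (fun j => f j.succ) fun j => hf _
    have hs := (hf 0).mul_norm h₁
    constructor
    · rw [← (Fin.consEquiv B).summable_iff]
      refine hs.congr fun x => ?_
      simp [Fin.prod_univ_succ, Fin.consEquiv]
    · rw [Fin.prod_univ_succ, ← h₂, tsum_mul_tsum_of_summable_norm (hf 0) h₁,
        ← (Fin.consEquiv B).tsum_eq]
      simp [Fin.prod_univ_succ, Fin.consEquiv]

/-- The elementary tensor `v₁ ⊗ ⋯ ⊗ vₙ`, with `ℓ²(B₁) ⊗ ⋯ ⊗ ℓ²(Bₙ)` identified with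
`ℓ²(B₁ × ⋯ × Bₙ)`. -/
noncomputable def tensPi {n : ℕ} {B : Fin n → Type} (v : ∀ j, L2 (B j)) : L2 (∀ j, B j) :=
  ⟨fun b => ∏ j, v j (b j), memℓp_of_summable <| by
    have := (tsum_pi (fun j b => ((‖v j b‖ ^ 2 : ℝ) : ℂ)) fun j => by
      simpa using summable_sq (v j)).1
    refine this.congr fun b => ?_
    simp [Finset.prod_pow]⟩

theorem tensPi_apply {n : ℕ} {B : Fin n → Type} (v : ∀ j, L2 (B j)) (b : ∀ j, B j) :
    tensPi v b = ∏ j, v j (b j) := rfl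

theorem inner_tensPi {n : ℕ} {B : Fin n → Type} (v w : ∀ j, L2 (B j)) :
    ⟪tensPi v, tensPi w⟫_ℂ = ∏ j, ⟪v j, w j⟫_ℂ := by
  simp only [lp.inner_eq_tsum]
  rw [← (tsum_pi (fun j b => ⟪v j b, w j b⟫_ℂ) fun j => summable_norm_inner _ _).2]
  refine tsum_congr fun b => ?_
  simp [tensPi_apply, Finset.prod_mul_distrib]

/-- The elementary tensor `v ⊗ w`, with `ℓ²(A) ⊗ ℓ²(B)` identified with `ℓ²(A × B)`. -/
noncomputable def tens {A B : Type} (v : L2 A) (w : L2 B) : L2 (A × B) :=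
  ⟨fun x => v x.1 * w x.2, memℓp_of_summable <| by
    have := (summable_sq v).mul_of_nonneg (summable_sq w) (fun _ => by positivity)
      (fun _ => by positivity)
    refine this.congr fun b => ?_
    simp [mul_pow]⟩

theorem tens_apply {A B : Type} (v : L2 A) (w : L2 B) (x : A × B) :
    tens v w x = v x.1 * w x.2 := rfl

theorem inner_tens {A B : Type} (v v' : L2 A) (w w' : L2 B) :
    ⟪tens v w, tens v' w'⟫_ℂ = ⟪v, v'⟫_ℂ * ⟪w, w'⟫_ℂ := by
  simp only [lp.inner_eq_tsum]
  rw [tsum_mul_tsum_of_summable_norm (summable_norm_inner _ _) (summable_norm_inner _ _)]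
  refine tsum_congr fun b => ?_
  simp [tens_apply]
  ring

theorem δ_pi {n : ℕ} {B : Fin n → Type} (b : ∀ j, B j) : δ b = tensPi fun j => δ (b j) := by
  classical
  ext c
  simp only [tensPi_apply, δ_apply, Finset.prod_ite_zero, Finset.prod_const_one]
  simp [funext_iff]

theorem δ_prod {A B : Type} (a : A) (b : B) : δ (a, b) = tens (δ a) (δ b) := by
  classical
  ext c
  simp only [tens_apply, δ_apply, Prod.ext_iff]
  split_ifs <;> simp_all

/-- The isometry that maps the canonical basis to a given orthonormal family. -/
noncomputable def ofOrtho {A : Type} {E : Type*} [NormedAddCommGroup E] [InnerProductSpace ℂ E]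
    [CompleteSpace E] (v : A → E) (hv : Orthonormal ℂ v) : L2 A →ₗᵢ[ℂ] E :=
  hv.orthogonalFamily.linearIsometry

theorem ofOrtho_δ {A : Type} {E : Type*} [NormedAddCommGroup E] [InnerProductSpace ℂ E]
    [CompleteSpace E] (v : A → E) (hv : Orthonormal ℂ v) (a : A) : ofOrtho v hv (δ a) = v a := by
  classical
  simp [ofOrtho, δ, OrthogonalFamily.linearIsometry_apply_single]

/-- The unitary `δ_a ↦ δ_{e a}`. -/
noncomputable def reindex {A B : Type} (e : A ≃ B) : L2 A →ₗᵢ[ℂ] L2 B :=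
  ofOrtho (fun a => δ (e a)) (orthonormal_δ.comp _ e.injective)

/-- The tensor product `S ⊗ T` of two isometries. -/
noncomputable def map {A A' B B' : Type} (S : L2 A →ₗᵢ[ℂ] L2 B) (T : L2 A' →ₗᵢ[ℂ] L2 B') :
    L2 (A × A') →ₗᵢ[ℂ] L2 (B × B') :=
  ofOrtho (fun a => tens (S (δ a.1)) (T (δ a.2))) <| by
    classical
    rw [orthonormal_iff_ite]
    intro a b
    rw [inner_tens, S.inner_map_map, T.inner_map_map, ← inner_tens, ← δ_prod, ← δ_prod]
    exact orthonormal_iff_ite.1 orthonormal_δ a b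

/-- The tensor product `S₁ ⊗ ⋯ ⊗ Sₙ` of isometries. -/
noncomputable def mapPi {n : ℕ} {A B : Fin n → Type} (S : ∀ j, L2 (A j) →ₗᵢ[ℂ] L2 (B j)) :
    L2 (∀ j, A j) →ₗᵢ[ℂ] L2 (∀ j, B j) :=
  ofOrtho (fun a => tensPi fun j => S j (δ (a j))) <| by
    classical
    rw [orthonormal_iff_ite]
    intro a b
    simp only [inner_tensPi, LinearIsometry.inner_map_map]
    rw [← inner_tensPi, ← δ_pi, ← δ_pi]
    exact orthonormal_iff_ite.1 orthonormal_δ a b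

/-- The adjoint of an isometry. -/
noncomputable def adj {A B : Type} (S : L2 A →ₗᵢ[ℂ] L2 B) : L2 B →L[ℂ] L2 A :=
  ContinuousLinearMap.adjoint S.toContinuousLinearMap

theorem adj_apply {A B : Type} (S : L2 A →ₗᵢ[ℂ] L2 B) (w : L2 B) (a : A) :
    adj S w a = ⟪S (δ a), w⟫_ℂ := by
  rw [← inner_δ, adj, ContinuousLinearMap.adjoint_inner_right]
  rfl

theorem ext_adj {A B : Type} {S T : L2 A →ₗᵢ[ℂ] L2 B} (h : ∀ b, adj S (δ b) = adj T (δ b)) :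
    S = T := by
  have : adj S = adj T := ext_inner h
  have := congrArg ContinuousLinearMap.adjoint this
  simp only [adj, ContinuousLinearMap.adjoint_adjoint] at this
  ext1 v
  exact DFunLike.congr_fun this v

theorem adj_comp {A B C : Type} (S : L2 B →ₗᵢ[ℂ] L2 C) (T : L2 A →ₗᵢ[ℂ] L2 B) (w : L2 C) :
    adj (S.comp T) w = adj T (adj S w) := by
  ext a
  rw [adj_apply, adj_apply, adj, ContinuousLinearMap.adjoint_inner_right]
  rfl

theorem adj_map {A A' B B' : Type} (S : L2 A →ₗᵢ[ℂ] L2 B) (T : L2 A' →ₗᵢ[ℂ] L2 B')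
    (v : L2 B) (w : L2 B') : adj (map S T) (tens v w) = tens (adj S v) (adj T w) := by
  ext a
  rw [adj_apply, map, ofOrtho_δ, inner_tens, tens_apply, adj_apply, adj_apply]

theorem adj_mapPi {n : ℕ} {A B : Fin n → Type} (S : ∀ j, L2 (A j) →ₗᵢ[ℂ] L2 (B j))
    (v : ∀ j, L2 (B j)) : adj (mapPi S) (tensPi v) = tensPi fun j => adj (S j) (v j) := by
  ext a
  rw [adj_apply, mapPi, ofOrtho_δ, inner_tensPi, tensPi_apply]
  simp only [adj_apply]

theorem adj_reindex {A B : Type} (e : A ≃ B) (v : L2 B) (a : A) :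
    adj (reindex e) v a = v (e a) := by
  rw [adj_apply, reindex, ofOrtho_δ, inner_δ]

theorem adj_reindex_δ {A B : Type} (e : A ≃ B) (b : B) :
    adj (reindex e) (δ b) = δ (e.symm b) := by
  classical
  ext a
  rw [adj_reindex, δ_apply, δ_apply]
  simp [Equiv.eq_symm_apply]

end L2

namespace LTree

/-- The leaves of a tree. -/
def Leaf {X : Type} : LTree X → Type
  | leaf _ => Unit
  | node l r => l.Leaf ⊕ r.Leaf

/-- The label of a leaf. -/
def label {X : Type} : ∀ t : LTree X, t.Leaf → X
  | leaf x => fun _ => x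
  | node l r => Sum.elim l.label r.label

instance instFintypeLeaf {X : Type} : ∀ t : LTree X, Fintype t.Leaf
  | leaf _ => inferInstanceAs (Fintype Unit)
  | node l r => letI := instFintypeLeaf l; letI := instFintypeLeaf r
    inferInstanceAs (Fintype (l.Leaf ⊕ r.Leaf))

theorem map_label {X : Type} (t : LTree X) :
    (Finset.univ : Finset t.Leaf).val.map t.label = (t.labels : Multiset X) := by
  induction t with
  | leaf x => rfl
  | node l r hl hr =>
    have : (Finset.univ : Finset (l.Leaf ⊕ r.Leaf)).val.map (Sum.elim l.label r.label) =
        ((l.labels ++ r.labels : List X) : Multiset X) := by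
      rw [← Multiset.coe_add, ← hl, ← hr, Finset.univ_disjSum_univ.symm, Finset.val_disjSum,
        Multiset.disjSum, Multiset.map_add, Multiset.map_map, Multiset.map_map]
      rfl
    exact this

end LTree

namespace LTree

/-- A function on the leaves of the trivial tree is one value. -/
def leafConfig {X : Type} (I : Type) (x : X) : I ≃ ((LTree.leaf x).Leaf → I) :=
  (Equiv.funUnique Unit I).symm

/-- A function on the leaves of a tree with a left and a right subtree is a pair of functions. -/
def nodeConfig {X : Type} (I : Type) (l r : LTree X) :
    (l.Leaf → I) × (r.Leaf → I) ≃ ((LTree.node l r).Leaf → I) :=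
  (Equiv.sumArrowEquivProdArrow l.Leaf r.Leaf I).symm

end LTree

namespace SForest

theorem label_bijective {n m : ℕ} (f : SForest n m) :
    Function.Bijective fun x : Σ j, (f.tree j).Leaf => (f.tree x.1).label x.2 := by
  have key : (Finset.univ : Finset (Σ j, (f.tree j).Leaf)).val.map
      (fun x => (f.tree x.1).label x.2) = (Finset.univ : Finset (Fin m)).val := by
    have h1 : (Finset.univ : Finset (Fin m)).val = (List.finRange m : Multiset (Fin m)) := rfl
    have h2 : (Finset.univ : Finset (Fin n)).val = (List.finRange n : Multiset (Fin n)) := rfl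
    have h3 : (Finset.univ : Finset (Σ j, (f.tree j).Leaf)).val =
      (Finset.univ : Finset (Fin n)).val.bind fun j =>
        (Finset.univ : Finset (f.tree j).Leaf).val.map (Sigma.mk j) := rfl
    rw [h1, ← Multiset.coe_eq_coe.2 f.perm, h3, Multiset.map_bind, h2]
    refine (Multiset.bind_congr fun j _ => ?_).trans
      (Multiset.coe_bind (List.finRange n) fun j => (f.tree j).labels)
    rw [Multiset.map_map, ← LTree.map_label]
    rfl
  constructor
  · intro x y hxy
    have hn := Finset.nodup (Finset.univ : Finset (Fin m))
    rw [← key] at hn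
    exact Multiset.inj_on_of_nodup_map hn x (Finset.mem_univ x) y (Finset.mem_univ y) hxy
  · intro y
    have : y ∈ (Finset.univ : Finset (Fin m)).val := Finset.mem_univ y
    rw [← key, Multiset.mem_map] at this
    obtain ⟨x, -, hx⟩ := this
    exact ⟨x, hx⟩

end SForest

/-- The isometry `Φ(t) : 𝔥 → 𝔥^{⊗ leaves}` of a tree `t`, where `𝔥 = ℓ²(I)`: the identity for the
trivial tree and `(Φ(l) ⊗ Φ(r)) R` for the tree with left subtree `l` and right subtree `r`. -/
noncomputable def LTree.isom {I X : Type} (R : L2 I →ₗᵢ[ℂ] L2 (I × I)) :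
    ∀ t : LTree X, L2 I →ₗᵢ[ℂ] L2 (t.Leaf → I)
  | .leaf x => L2.reindex (LTree.leafConfig I x)
  | .node l r => (L2.reindex (LTree.nodeConfig I l r)).comp
      ((L2.map (l.isom R) (r.isom R)).comp R)

namespace SForest

/-- The leaves of a symmetric forest are in bijection with their labels. -/
noncomputable def leafEquiv {n m : ℕ} (f : SForest n m) : (Σ j, (f.tree j).Leaf) ≃ Fin m :=
  Equiv.ofBijective _ f.label_bijective

theorem leafEquiv_apply {n m : ℕ} (f : SForest n m) (j : Fin n) (x : (f.tree j).Leaf) :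
    f.leafEquiv ⟨j, x⟩ = (f.tree j).label x := rfl

/-- A function on the leaves of the trees of a symmetric forest, as a function of the labels. -/
noncomputable def assemble {n m : ℕ} (f : SForest n m) (I : Type) :
    (∀ j, (f.tree j).Leaf → I) ≃ (Fin m → I) :=
  (Equiv.piCurry fun _ _ => I).symm.trans (Equiv.arrowCongr f.leafEquiv (Equiv.refl I))

theorem assemble_symm_apply {n m : ℕ} (f : SForest n m) {I : Type} (k : Fin m → I) (j : Fin n) :
    (f.assemble I).symm k j = k ∘ (f.tree j).label := rfl

/-- The functor `Φ` of an isometry `R : 𝔥 → 𝔥 ⊗ 𝔥`, where `𝔥 = ℓ²(I)` and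
`𝔥^{⊗ n} = ℓ²(Iⁿ)`: it maps the symmetric forest `f = (p, τ)` to `θ(τ) (Φ(p₁) ⊗ ⋯ ⊗ Φ(pₙ))`, where
`p₁, …, pₙ` are the trees of `p`, and `θ(τ)` permutes the tensor factors, moving the factor of the
`i`-th leaf to the position `τ i`, which is its label. In particular `Φ` maps the forest whose
`i`-th tree has two leaves, all others being trivial, to `1 ⊗ ⋯ ⊗ R ⊗ ⋯ ⊗ 1`. -/
noncomputable def Φ {I : Type} (R : L2 I →ₗᵢ[ℂ] L2 (I × I)) {n m : ℕ} (f : SForest n m) :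
    L2 (Fin n → I) →ₗᵢ[ℂ] L2 (Fin m → I) :=
  (L2.reindex (f.assemble I)).comp (L2.mapPi fun j => (f.tree j).isom R)

end SForest

section Functor

variable {I : Type} (R : L2 I →ₗᵢ[ℂ] L2 (I × I))

/-- A row of the matrix of the isometry of a tree. -/
noncomputable def LTree.row {X : Type} (t : LTree X) (k : X → I) : L2 I :=
  L2.adj (t.isom R) (L2.δ (k ∘ t.label))

/-- The tensor product, over the leaves of `t`, of rows of the trees glued on `t`. -/
noncomputable def LTree.vec {X Y : Type} (p : X → LTree Y) (k : Y → I) :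
    ∀ t : LTree X, L2 (t.Leaf → I)
  | .leaf x => L2.reindex (LTree.leafConfig I x) ((p x).row R k)
  | .node l r => L2.reindex (LTree.nodeConfig I l r)
      (L2.tens (l.vec p k) (r.vec p k))

theorem L2.reindex_apply {A B : Type} (e : A ≃ B) (v : L2 A) (a : A) :
    L2.reindex e v (e a) = v a := by
  rw [← L2.adj_reindex, ← L2.inner_δ, L2.adj, ContinuousLinearMap.adjoint_inner_right]
  change inner ℂ (L2.reindex e (L2.δ a)) (L2.reindex e v) = _
  rw [LinearIsometry.inner_map_map, L2.inner_δ]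

theorem L2.adj_self {A B : Type} (S : L2 A →ₗᵢ[ℂ] L2 B) (v : L2 A) : L2.adj S (S v) = v := by
  refine ext_inner_left ℂ fun w => ?_
  rw [L2.adj, ContinuousLinearMap.adjoint_inner_right]
  exact S.inner_map_map w v

theorem LTree.row_node {X : Type} (l r : LTree X) (k : X → I) :
    (LTree.node l r).row R k = L2.adj R (L2.tens (l.row R k) (r.row R k)) := by
  rw [row, isom, L2.adj_comp, L2.adj_comp, L2.adj_reindex_δ]
  have : (LTree.nodeConfig I l r).symm (k ∘ (LTree.node l r).label) =
    (k ∘ l.label, k ∘ r.label) := rfl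
  rw [this, L2.δ_prod, L2.adj_map]
  rfl

theorem LTree.adj_isom_vec {X Y : Type} (p : X → LTree Y) (k : Y → I) (t : LTree X) :
    L2.adj (t.isom R) (t.vec R p k) = (t.bind p).row R k := by
  induction t with
  | leaf x => exact L2.adj_self _ _
  | node l r hl hr =>
    rw [isom, vec, L2.adj_comp, L2.adj_comp, L2.adj_self, L2.adj_map, hl, hr, bind, row_node]

theorem LTree.vec_apply {X Y : Type} (p : X → LTree Y) (k : Y → I) (t : LTree X)
    (h : t.Leaf → I) : t.vec R p k h = ∏ x, (p (t.label x)).row R k (h x) := by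
  induction t with
  | leaf x =>
    have h1 : h = LTree.leafConfig I x (h ()) := rfl
    have : (LTree.leaf x).vec R p k h = (p x).row R k (h ()) := by
      rw [h1]
      exact L2.reindex_apply _ _ _
    rw [this]
    exact (Fintype.prod_unique (ι := Unit) fun _ => (p x).row R k (h ())).symm
  | node l r hl hr =>
    have h1 : h = LTree.nodeConfig I l r (h ∘ Sum.inl, h ∘ Sum.inr) := by
      funext x; cases x <;> rfl
    have : (LTree.node l r).vec R p k h = l.vec R p k (h ∘ Sum.inl) * r.vec R p k (h ∘ Sum.inr) := by
      conv_lhs => rw [h1]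
      exact L2.reindex_apply _ _ _
    rw [this, hl, hr]
    exact (Fintype.prod_sumElim (fun x => (p (l.label x)).row R k (h (Sum.inl x)))
      (fun x => (p (r.label x)).row R k (h (Sum.inr x)))).symm.trans
      (Fintype.prod_congr _ _ fun x => by cases x <;> rfl)

theorem SForest.adj_Φ {n m : ℕ} (f : SForest n m) (k : Fin m → I) :
    L2.adj (f.Φ R) (L2.δ k) = L2.tensPi fun j => (f.tree j).row R k := by
  rw [Φ, L2.adj_comp, L2.adj_reindex_δ, L2.δ_pi, L2.adj_mapPi]
  rfl

theorem SForest.Φ_comp {n m l : ℕ} (p : SForest m l) (q : SForest n m) :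
    (p.comp q).Φ R = (p.Φ R).comp (q.Φ R) := by
  refine L2.ext_adj fun k => ?_
  rw [L2.adj_comp, adj_Φ, adj_Φ, Φ, L2.adj_comp]
  have : L2.adj (L2.reindex (q.assemble I)) (L2.tensPi fun y => (p.tree y).row R k) =
      L2.tensPi fun j => (q.tree j).vec R p.tree k := by
    ext h
    rw [L2.adj_reindex, L2.tensPi_apply, L2.tensPi_apply]
    simp only [LTree.vec_apply]
    rw [← Fintype.prod_equiv q.leafEquiv _ _ fun _ => rfl, Fintype.prod_sigma]
    refine Fintype.prod_congr _ _ fun j => Fintype.prod_congr _ _ fun x => ?_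
    rw [leafEquiv_apply]
    have := congrFun (congrFun ((q.assemble I).symm_apply_apply h) j) x
    exact congrArg _ this
  rw [this, L2.adj_mapPi]
  congr 1
  funext j
  exact (LTree.adj_isom_vec R p.tree k (q.tree j)).symm

theorem SForest.Φ_id (n : ℕ) : (SForest.id n).Φ R = LinearIsometry.id := by
  classical
  refine L2.ext_adj fun k => ?_
  rw [adj_Φ]
  have h : L2.adj (LinearIsometry.id : L2 (Fin n → I) →ₗᵢ[ℂ] _) (L2.δ k) = L2.δ k :=
    L2.adj_self LinearIsometry.id _
  rw [h, L2.δ_pi]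
  congr 1
  funext j
  change L2.adj (L2.reindex (LTree.leafConfig I j)) (L2.δ (k ∘ fun _ => j)) = _
  rw [L2.adj_reindex_δ]
  rfl

end Functor

/-- The isometry `Φ(p)`, where `s = p ∘ t`. -/
noncomputable def growthMap {I : Type} (R : L2 I →ₗᵢ[ℂ] L2 (I × I)) (t s : STree) (h : t ≤ s) :
    L2 (Fin t.n → I) →ₗᵢ[ℂ] L2 (Fin s.n → I) := (STree.growth h).Φ R

instance {I : Type} (R : L2 I →ₗᵢ[ℂ] L2 (I × I)) :
    DirectedSystem (fun t : STree => L2 (Fin t.n → I)) (growthMap R · · ·) where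
  map_self t x := by simp [growthMap, STree.growth_self, SForest.Φ_id]
  map_map k j i hij hjk x := by
    simp [growthMap, STree.growth_trans hij hjk (hij.trans hjk), SForest.Φ_comp]

/-- The pre-Hilbert space of all pairs `(t, ξ)`, with `t` a symmetric tree with `n` leaves and
`ξ ∈ 𝔥^{⊗ n}`, modulo the equivalence relation generated by `(t, ξ) ∼ (p ∘ t, Φ(p) ξ)`. -/
def PreJones {I : Type} (R : L2 I →ₗᵢ[ℂ] L2 (I × I)) : Type :=
  DirectLimit (fun t : STree => L2 (Fin t.n → I)) (growthMap R)

namespace PreJones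

variable {I : Type} (R : L2 I →ₗᵢ[ℂ] L2 (I × I))

noncomputable instance : AddCommGroup (PreJones R) :=
  inferInstanceAs (AddCommGroup (DirectLimit (fun t : STree => L2 (Fin t.n → I)) (growthMap R)))

noncomputable instance : Module ℂ (PreJones R) :=
  inferInstanceAs (Module ℂ (DirectLimit (fun t : STree => L2 (Fin t.n → I)) (growthMap R)))

/-- The class of `(t, ξ)`. -/
noncomputable def mk {n : ℕ} (t : SForest 1 n) (ξ : L2 (Fin n → I)) : PreJones R :=
  (⟦⟨⟨n, t⟩, ξ⟩⟧ : DirectLimit (fun t : STree => L2 (Fin t.n → I)) (growthMap R))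

/-- `⟨(t, ξ), (t, η)⟩ = ⟨ξ, η⟩`. -/
noncomputable instance : Inner ℂ (PreJones R) :=
  ⟨DirectLimit.lift₂ (growthMap R) (growthMap R) (fun _ ξ η => inner ℂ ξ η)
    fun _ _ _ ξ η => (LinearIsometry.inner_map_map _ ξ η).symm⟩

variable {R}

theorem exists_mk (x : PreJones R) : ∃ (n : ℕ) (t : SForest 1 n) (ξ : _), x = mk R t ξ := by
  obtain ⟨⟨n, t⟩, ξ, h⟩ := DirectLimit.exists_eq_mk (growthMap R) x
  exact ⟨n, t, ξ, h⟩

theorem exists_mk₂ (x y : PreJones R) :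
    ∃ (n : ℕ) (t : SForest 1 n) (ξ η : _), x = mk R t ξ ∧ y = mk R t η := by
  obtain ⟨⟨n, t⟩, ξ, η, h⟩ := DirectLimit.exists_eq_mk₂ (growthMap R) x y
  exact ⟨n, t, ξ, η, h⟩

theorem mk_comp {n m : ℕ} (p : SForest n m) (t : SForest 1 n) (ξ : L2 (Fin n → I)) :
    mk R (p.comp t) (p.Φ R ξ) = mk R t ξ :=
  mk_growth (F := fun n => L2 (Fin n → I)) (fun p => p.Φ R) (growthMap R) (fun _ _ _ _ => rfl) p t ξ

theorem mk_add {n : ℕ} (t : SForest 1 n) (ξ η : L2 (Fin n → I)) :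
    mk R t (ξ + η) = mk R t ξ + mk R t η :=
  (DirectLimit.add_def (G := fun t : STree => L2 (Fin t.n → I)) (f := growthMap R)
    ⟨n, t⟩ ξ η).symm

theorem mk_smul {n : ℕ} (t : SForest 1 n) (c : ℂ) (ξ : L2 (Fin n → I)) :
    mk R t (c • ξ) = c • mk R t ξ := rfl

theorem mk_zero {n : ℕ} (t : SForest 1 n) : mk R t 0 = 0 := by
  simpa using mk_smul (R := R) t 0 0

theorem inner_mk {n : ℕ} (t : SForest 1 n) (ξ η : L2 (Fin n → I)) :
    inner ℂ (mk R t ξ) (mk R t η) = inner ℂ ξ η :=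
  DirectLimit.lift₂_def (F₁ := fun t : STree => L2 (Fin t.n → I))
    (F₂ := fun t : STree => L2 (Fin t.n → I)) (growthMap R) (growthMap R) _ _ ⟨n, t⟩ ξ η

/-- The inner product space structure. -/
noncomputable abbrev core : InnerProductSpace.Core ℂ (PreJones R) where
  conj_inner_symm x y := by
    obtain ⟨n, t, ξ, η, rfl, rfl⟩ := exists_mk₂ x y
    rw [inner_mk, inner_mk, inner_conj_symm]
  re_inner_nonneg x := by
    obtain ⟨n, t, ξ, rfl⟩ := exists_mk x
    rw [inner_mk]
    exact inner_self_nonneg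
  add_left x y z := by
    obtain ⟨n, t, ξ, η, rfl, rfl⟩ := exists_mk₂ x y
    obtain ⟨m, s, ζ, rfl⟩ := exists_mk z
    obtain ⟨N, u, p, q, hp, hq, -⟩ := SForest.exists_common t s
    rw [← mk_add, ← mk_comp p t, ← mk_comp p t ξ, ← mk_comp p t η, ← mk_comp q s, hp, hq,
      inner_mk, inner_mk, inner_mk, map_add, inner_add_left]
  smul_left x y c := by
    obtain ⟨n, t, ξ, η, rfl, rfl⟩ := exists_mk₂ x y
    rw [← mk_smul, inner_mk, inner_mk, inner_smul_left]
  definite x h := by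
    obtain ⟨n, t, ξ, rfl⟩ := exists_mk x
    rw [inner_mk, inner_self_eq_zero] at h
    rw [h, mk_zero]

noncomputable instance : NormedAddCommGroup (PreJones R) := core.toNormedAddCommGroup

noncomputable instance : InnerProductSpace ℂ (PreJones R) := .ofCore core.toCore

variable (R) in
/-- The action of `V`: `(t / s) (s, ξ) = (t, ξ)`. -/
noncomputable def act (g : ThompsonV) (x : PreJones R) : PreJones R :=
  transport (F := fun n => L2 (Fin n → I)) (fun p => p.Φ R) (growthMap R) (fun _ _ _ _ => rfl)
    (g⁻¹ : ThompsonV) x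

theorem act_frac {n : ℕ} (t s : SForest 1 n) (ξ : L2 (Fin n → I)) :
    act R (.frac t s) (mk R s ξ) = mk R t ξ :=
  transport_mk (F := fun n => L2 (Fin n → I)) (fun p => p.Φ R) (growthMap R) (fun _ _ _ _ => rfl) s t ξ

theorem exists_frac_mk₂ (g : ThompsonV) (x y : PreJones R) :
    ∃ (n : ℕ) (t s : SForest 1 n) (ξ η : _), g = .frac t s ∧ x = mk R s ξ ∧ y = mk R s η := by
  obtain ⟨n, t, s, rfl⟩ := g.exists_frac
  obtain ⟨m, r, ξ, η, rfl, rfl⟩ := exists_mk₂ x y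
  obtain ⟨N, u, p, q, hp, hq, -⟩ := SForest.exists_common s r
  refine ⟨N, p.comp t, u, q.Φ R ξ, q.Φ R η, ?_, ?_, ?_⟩
  · rw [← hp, ThompsonV.frac_comp]
  · rw [← hq, mk_comp]
  · rw [← hq, mk_comp]

theorem act_mul (g h : ThompsonV) (x : PreJones R) : act R (g * h) x = act R g (act R h x) := by
  obtain ⟨n, t, s, ξ, -, rfl, rfl, -⟩ := exists_frac_mk₂ h x x
  obtain ⟨m, a, b, rfl⟩ := g.exists_frac
  obtain ⟨N, u, p, q, hp, hq, -⟩ := SForest.exists_common b t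
  rw [← ThompsonV.frac_comp p a b, ← ThompsonV.frac_comp q t s, ← mk_comp q s, hp, hq,
    ThompsonV.frac_mul, act_frac, act_frac, act_frac]

theorem act_one (x : PreJones R) : act R 1 x = x := by
  obtain ⟨n, t, ξ, rfl⟩ := exists_mk x
  rw [← ThompsonV.frac_self t, act_frac]

variable (R) in
/-- The action of an element of `V`, as a linear isometry. -/
noncomputable def actₗᵢ (g : ThompsonV) : PreJones R →ₗᵢ[ℂ] PreJones R where
  toFun := act R g
  map_add' x y := by
    obtain ⟨n, t, s, ξ, η, rfl, rfl, rfl⟩ := exists_frac_mk₂ g x y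
    rw [← mk_add, act_frac, act_frac, act_frac, mk_add]
  map_smul' c x := by
    obtain ⟨n, t, s, ξ, -, rfl, rfl, -⟩ := exists_frac_mk₂ g x x
    rw [← mk_smul, act_frac, act_frac, mk_smul, RingHom.id_apply]
  norm_map' x := by
    obtain ⟨n, t, s, ξ, -, rfl, rfl, -⟩ := exists_frac_mk₂ g x x
    change ‖act R (.frac t s) (mk R s ξ)‖ = ‖mk R s ξ‖
    rw [act_frac, @norm_eq_sqrt_re_inner ℂ, @norm_eq_sqrt_re_inner ℂ, inner_mk, inner_mk]

end PreJones

/-- The Hilbert space `ℋ`, completion of the space of classes of pairs `(t, ξ)`. -/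
abbrev JonesSpace {I : Type} (R : L2 I →ₗᵢ[ℂ] L2 (I × I)) : Type :=
  UniformSpace.Completion (PreJones R)

section Rep

variable {I : Type} (R : L2 I →ₗᵢ[ℂ] L2 (I × I))

/-- The class of `(t, ξ)` in `ℋ`. -/
noncomputable def JonesSpace.mk {n : ℕ} (t : SForest 1 n) (ξ : L2 (Fin n → I)) : JonesSpace R :=
  (PreJones.mk R t ξ : UniformSpace.Completion (PreJones R))

/-- The extension by continuity to `ℋ` of the action of an element of `V`. -/
noncomputable def jonesMap (g : ThompsonV) : JonesSpace R →L[ℂ] JonesSpace R :=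
  (PreJones.actₗᵢ R g).toContinuousLinearMap.completion

theorem jonesMap_coe (g : ThompsonV) (x : PreJones R) :
    jonesMap R g x = (PreJones.act R g x : UniformSpace.Completion (PreJones R)) :=
  ContinuousLinearMap.completion_apply_coe _ _

theorem jonesMap_mul (g h : ThompsonV) (x : JonesSpace R) :
    jonesMap R (g * h) x = jonesMap R g (jonesMap R h x) := by
  induction x using UniformSpace.Completion.induction_on with
  | hp => exact isClosed_eq (by fun_prop) (by fun_prop)
  | ih x => simp only [jonesMap_coe, PreJones.act_mul]

theorem jonesMap_one (x : JonesSpace R) : jonesMap R 1 x = x := by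
  induction x using UniformSpace.Completion.induction_on with
  | hp => exact isClosed_eq (by fun_prop) (by fun_prop)
  | ih x => simp only [jonesMap_coe, PreJones.act_one]

theorem norm_jonesMap (g : ThompsonV) (x : JonesSpace R) : ‖jonesMap R g x‖ = ‖x‖ := by
  induction x using UniformSpace.Completion.induction_on with
  | hp => exact isClosed_eq (by fun_prop) (by fun_prop)
  | ih x =>
    rw [jonesMap_coe, UniformSpace.Completion.norm_coe, UniformSpace.Completion.norm_coe]
    exact (PreJones.actₗᵢ R g).norm_map x

/-- The unitary representation `π : V → U(ℋ)`, with `π(t / s) (s, ξ) = (t, ξ)`. In terms of plain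
trees `s`, `t` and vectors `ξ`, this reads
`π((t, τ) / (s, σ)) (s, ξ) = (t, θ(τ⁻¹ σ) ξ)`. -/
noncomputable def jonesRep : ThompsonV →* (JonesSpace R ≃ₗᵢ[ℂ] JonesSpace R) where
  toFun g :=
    { toFun := jonesMap R g
      invFun := jonesMap R g⁻¹
      map_add' := map_add _
      map_smul' := map_smul _
      left_inv := fun x => by rw [← jonesMap_mul, inv_mul_cancel, jonesMap_one]
      right_inv := fun x => by rw [← jonesMap_mul, mul_inv_cancel, jonesMap_one]
      norm_map' := norm_jonesMap R g }
  map_one' := by ext x; exact jonesMap_one R x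
  map_mul' g h := by ext x; exact jonesMap_mul R g h x

theorem jonesRep_frac {n : ℕ} (t s : SForest 1 n) (ξ : L2 (Fin n → I)) :
    jonesRep R (.frac t s) (JonesSpace.mk R s ξ) = JonesSpace.mk R t ξ := by
  change jonesMap R _ _ = _
  rw [JonesSpace.mk, jonesMap_coe, PreJones.act_frac]
  rfl

end Rep

/-- The free group `𝔽₂`. -/
abbrev F2 : Type := FreeGroup (Fin 2)

namespace F2

/-- The first free generator. -/
def a : F2 := FreeGroup.of 0

/-- The second free generator. -/
def b : F2 := FreeGroup.of 1

theorem a_ne_b : a ≠ b := fun h => by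
  have := FreeGroup.of_injective h
  simp at this

end F2

open Classical in
/-- The vectors `R_α δ_g`: `α δ_{e,e} + √(1 - α²) δ_{a,b}` if `g = e`, and `δ_{ag,bg}` if `g ≠ e`. -/
noncomputable def RαBasis (α : unitInterval) (g : F2) : L2 (F2 × F2) :=
  if g = 1 then ((α : ℝ) : ℂ) • L2.δ (1, 1) + ((√(1 - (α : ℝ) ^ 2) : ℝ) : ℂ) • L2.δ (F2.a, F2.b)
  else L2.δ (F2.a * g, F2.b * g)

theorem orthonormal_RαBasis (α : unitInterval) : Orthonormal ℂ (RαBasis α) := by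
  classical
  have hsq : √(1 - (α : ℝ) ^ 2) * √(1 - (α : ℝ) ^ 2) = 1 - (α : ℝ) ^ 2 :=
    Real.mul_self_sqrt (by have := α.2.1; have := α.2.2; nlinarith)
  have ha : F2.a ≠ 1 := FreeGroup.of_ne_one _
  have hδ : ∀ x y : F2 × F2, inner ℂ (L2.δ x) (L2.δ y) = if x = y then (1 : ℂ) else 0 :=
    orthonormal_iff_ite.1 L2.orthonormal_δ
  have key : ∀ g : F2, g ≠ 1 → (F2.a * g, F2.b * g) ≠ (1, 1) ∧
      (F2.a * g, F2.b * g) ≠ (F2.a, F2.b) := by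
    intro g hg
    refine ⟨fun h => F2.a_ne_b ?_, fun h => hg ?_⟩
    · simp only [Prod.mk.injEq] at h
      exact mul_right_cancel (h.1.trans h.2.symm)
    · simpa using h
  rw [orthonormal_iff_ite]
  intro g h
  by_cases hg : g = 1 <;> by_cases hh : h = 1
  · subst hg hh
    have e1 : ((1, 1) : F2 × F2) ≠ (F2.a, F2.b) := by simp [Ne.symm ha]
    simp only [RαBasis, if_true, inner_add_left, inner_add_right, inner_smul_left,
      inner_smul_right, hδ, if_neg e1, if_neg e1.symm, Complex.conj_ofReal]
    have := congrArg (fun x : ℝ => (x : ℂ)) hsq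
    push_cast at this ⊢
    linear_combination this
  · subst hg
    simp only [RαBasis, if_true, if_neg hh, inner_add_left, inner_smul_left, hδ,
      if_neg (key h hh).1.symm, if_neg (key h hh).2.symm, if_neg (Ne.symm hh)]
    simp
  · subst hh
    simp only [RαBasis, if_true, if_neg hg, inner_add_right, inner_smul_right, hδ,
      if_neg (key g hg).1, if_neg (key g hg).2]
    simp
  · simp only [RαBasis, if_neg hg, if_neg hh, hδ, Prod.mk.injEq, mul_right_inj, and_self]

/-- The isometry `R_α : ℓ²(𝔽₂) → ℓ²(𝔽₂ × 𝔽₂)`. -/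
noncomputable def Rα (α : unitInterval) : L2 F2 →ₗᵢ[ℂ] L2 (F2 × F2) :=
  L2.ofOrtho (RαBasis α) (orthonormal_RαBasis α)

/-- The unitary representation `π_α` of `V`. -/
noncomputable def πα (α : unitInterval) :
    ThompsonV →* (JonesSpace (Rα α) ≃ₗᵢ[ℂ] JonesSpace (Rα α)) := jonesRep (Rα α)

/-- The unit vector `δ_e ∈ 𝔥 ⊆ ℋ`, i.e. the class of `(trivial tree, δ_e)`. -/
noncomputable def vacuum (α : unitInterval) : JonesSpace (Rα α) :=
  JonesSpace.mk (Rα α) (SForest.id 1) (L2.δ fun _ => 1)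

/-- The function `φ_α(g) = ⟨π_α(g) δ_e, δ_e⟩` (the inner product of Mathlib is linear in the second
variable). -/
noncomputable def φα (α : unitInterval) (g : ThompsonV) : ℂ :=
  inner ℂ (vacuum α) (πα α g (vacuum α))

open scoped ComplexOrder in
/-- Positive definite functions on a group: the matrices `(φ(xᵢ⁻¹ xⱼ))ᵢⱼ` are positive
semidefinite. -/
def IsPositiveDefinite {G : Type*} [Group G] (φ : G → ℂ) : Prop :=
  ∀ (n : ℕ) (x : Fin n → G), (Matrix.of fun i j => φ ((x i)⁻¹ * x j)).PosSemidef

/-- The Haagerup property of a countable discrete group: there is a sequence of positive definite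
functions that vanish at infinity and converge pointwise to `1`. -/
def HasHaagerupProperty (G : Type*) [Group G] : Prop :=
  Countable G ∧ ∃ φ : ℕ → G → ℂ,
    (∀ n, IsPositiveDefinite (φ n)) ∧
    (∀ n, Filter.Tendsto (φ n) Filter.cofinite (nhds 0)) ∧
    ∀ g, Filter.Tendsto (fun n => φ n g) Filter.atTop (nhds 1)

end Thompson

/-! Expanding both copies of the vacuum along t and s gives φ_α(t/s) = ⟨Φ(t)δ_e, Φ(s)δ_e⟩
(`φα_frac`), a sum over the configurations k that put an element of 𝔽₂ on every leaf. The
coefficient of k in Φ(t)δ_e is read off by descending from the root. A vertex carrying e passes on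
either e, e with factor α, or a, b with factor √(1-α²); a vertex carrying a word g ≠ e passes on ag,
bg. Hence in the support all leaves carry positive words, and nonempty words get strictly longer on
the way up the tree.

The key is that for a reduced affine pair only the constant configuration e has nonzero coefficients
in both trees (`eq_one_of_row_ne_zero`). Otherwise t has a caret whose leaves x, y carry aw, bw
(`exists_hasCaret_of_row_one_ne_zero`). In s the leaf x carries aw, so it is a left child whose
sibling subtree carries bw at its root. In an affine tree the label of the next leaf is determined
by the label of the leaf, so y follows x in s too and is the first leaf of that sibling subtree. As
y carries bw itself, the subtree is trivial (`eq_leaf_or_exists_next`). Thus x, y is a caret of both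
trees and can be cancelled, contradicting reducedness. The constant configuration contributes
α^{n-1} from each tree, one α per inner vertex.

A pair of minimal size for an element of T can be renumbered to be affine (`exists_isReduced`), and
there are finitely many fractions of each size. So φ_α vanishes at infinity on T for α < 1, and
α^{2n-2} → 1 as α → 1 with n fixed. Positive definiteness holds because φ_α is a coefficient of a
unitary representation. -/

namespace Thompson

/-! ### Positive words in the free group -/

namespace F2

/-- The positive word in `a`, `b` given by a list of letters. -/
def posWord (L : List (Fin 2)) : F2 := FreeGroup.mk (L.map (·, true))

theorem posWord_zero_cons (L : List (Fin 2)) : posWord (0 :: L) = a * posWord L := rfl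

theorem posWord_one_cons (L : List (Fin 2)) : posWord (1 :: L) = b * posWord L := rfl

theorem posWord_nil : posWord [] = 1 := rfl

/-- Without inverse letters nothing cancels: a positive word is already reduced, so its letters can
be read off from the group element. -/
theorem posWord_injective : Function.Injective posWord := by
  intro L M h
  have red : ∀ L : List (Fin 2), (posWord L).toWord = L.map (·, true) := fun L => by
    rw [posWord, FreeGroup.toWord_mk]
    refine FreeGroup.IsReduced.reduce_eq ?_
    rw [FreeGroup.IsReduced, List.isChain_map]
    -- All signs are `true`, so the condition on neighbouring letters is trivial;
    -- `List.isChain_isInfix` only provides some chain to weaken.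
    exact (List.isChain_isInfix L).imp fun _ _ _ _ => rfl
  have := red L
  rw [h, red M] at this
  exact (List.map_injective_iff.2 (fun x y hxy => congrArg Prod.fst hxy) this).symm

theorem posWord_eq_one_iff {L : List (Fin 2)} : posWord L = 1 ↔ L = [] :=
  posWord_injective.eq_iff' posWord_nil

end F2

open F2

/-! ### Carets and the coefficients of tree isometries -/

namespace LTree

variable {X : Type}

/-- Two leaves with labels `x` and `y` are siblings: they form a caret. -/
inductive HasCaret (x y : X) : LTree X → Prop
  | here : HasCaret x y (node (leaf x) (leaf y))
  | left {l r : LTree X} : HasCaret x y l → HasCaret x y (node l r)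
  | right {l r : LTree X} : HasCaret x y r → HasCaret x y (node l r)

/-- Siblings are neighbours in the left-to-right order; for affine trees this ties y to x. -/
theorem HasCaret.infix {x y : X} {t : LTree X} (h : t.HasCaret x y) : [x, y] <:+: t.labels := by
  induction h with
  | here => exact List.infix_rfl
  | left _ ih => exact ih.trans (List.prefix_append _ _).isInfix
  | right _ ih => exact ih.trans (List.suffix_append _ _).isInfix

section Rows

variable (α : unitInterval)

theorem row_leaf {I : Type} (R : L2 I →ₗᵢ[ℂ] L2 (I × I)) (x : X) (k : X → I) :
    (leaf x).row R k = L2.δ (k x) := by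
  change L2.adj (L2.reindex (leafConfig I x)) (L2.δ (k ∘ fun _ => x)) = _
  rw [L2.adj_reindex_δ]
  rfl

/-- `t.row R k g` is the coefficient ⟨Φ(t)δ_g, δ_k⟩; the two terms come from the two summands of R_α
δ_e, whose coefficients are real. -/
theorem row_node_one (l r : LTree X) (k : X → F2) :
    (node l r).row (Rα α) k 1 =
      ((α : ℝ) : ℂ) * (l.row (Rα α) k 1 * r.row (Rα α) k 1) +
      ((√(1 - (α : ℝ) ^ 2) : ℝ) : ℂ) * (l.row (Rα α) k a * r.row (Rα α) k b) := by
  rw [row_node, L2.adj_apply, Rα, L2.ofOrtho_δ, RαBasis, if_pos rfl, inner_add_left,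
    inner_smul_left, inner_smul_left, L2.inner_δ, L2.inner_δ, L2.tens_apply, L2.tens_apply,
    Complex.conj_ofReal, Complex.conj_ofReal]

theorem row_node_of_ne (l r : LTree X) (k : X → F2) {g : F2} (hg : g ≠ 1) :
    (node l r).row (Rα α) k g = l.row (Rα α) k (a * g) * r.row (Rα α) k (b * g) := by
  rw [row_node, L2.adj_apply, Rα, L2.ofOrtho_δ, RαBasis, if_neg hg, L2.inner_δ, L2.tens_apply]

variable {α}

/-- In the node case, either both subtrees carry the vector `δ_e`, or the positive word at the root
is prolonged by `a` on the left and by `b` on the right. -/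
theorem row_node_ne_zero {l r : LTree X} {k : X → F2} {M : List (Fin 2)}
    (h : (node l r).row (Rα α) k (posWord M) ≠ 0) :
    (M = [] ∧ l.row (Rα α) k (posWord []) ≠ 0 ∧ r.row (Rα α) k (posWord []) ≠ 0) ∨
      (l.row (Rα α) k (posWord (0 :: M)) ≠ 0 ∧ r.row (Rα α) k (posWord (1 :: M)) ≠ 0) := by
  by_cases hM : M = []
  · subst hM
    rw [posWord_nil, row_node_one] at h
    by_contra! hc
    refine h ?_
    obtain ⟨h1, h2⟩ := hc
    simp only [posWord_zero_cons, posWord_one_cons, posWord_nil, mul_one, forall_const] at h1 h2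
    have e1 : l.row (Rα α) k 1 * r.row (Rα α) k 1 = 0 := by
      rw [mul_eq_zero]; tauto
    have e2 : l.row (Rα α) k a * r.row (Rα α) k b = 0 := by
      rw [mul_eq_zero]; tauto
    rw [e1, e2, mul_zero, mul_zero, add_zero]
  · rw [row_node_of_ne _ _ _ _ (mt posWord_eq_one_iff.1 hM)] at h
    exact .inr (mul_ne_zero_iff.1 h)

theorem row_leaf_ne_zero {R : L2 F2 →ₗᵢ[ℂ] L2 (F2 × F2)} {x : X} {k : X → F2} {g : F2}
    (h : (leaf x).row R k g ≠ 0) : k x = g := by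
  classical
  rw [row_leaf, L2.δ_apply] at h
  exact (ite_ne_right_iff.1 h).1.symm

/-- A nonempty word excludes the branch with factor α, so each level of the tree puts one more
letter in front of the word. -/
theorem exists_posWord_of_row_ne_zero {t : LTree X} {k : X → F2} {M : List (Fin 2)}
    (hM : M ≠ []) (h : t.row (Rα α) k (posWord M) ≠ 0) {y : X} (hy : y ∈ t.labels) :
    ∃ N, k y = posWord N ∧ M.length ≤ N.length := by
  induction t generalizing M with
  | leaf x =>
    obtain rfl : y = x := by simpa [labels] using hy
    exact ⟨M, row_leaf_ne_zero h, le_rfl⟩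
  | node l r hl hr =>
    obtain ⟨rfl, -⟩ | ⟨h1, h2⟩ := row_node_ne_zero h
    · exact absurd rfl hM
    rcases List.mem_append.1 hy with hy | hy
    · obtain ⟨N, hN, hN'⟩ := hl (by simp) h1 hy
      exact ⟨N, hN, (Nat.le_succ _).trans hN'⟩
    · obtain ⟨N, hN, hN'⟩ := hr (by simp) h2 hy
      exact ⟨N, hN, (Nat.le_succ _).trans hN'⟩

/-- If the label of some leaf is the word at the root, the tree is trivial. -/
theorem eq_leaf_of_row_ne_zero {t : LTree X} {k : X → F2} {M : List (Fin 2)}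
    (hM : M ≠ []) (h : t.row (Rα α) k (posWord M) ≠ 0) {y : X} (hy : y ∈ t.labels)
    (hk : k y = posWord M) : t = leaf y := by
  cases t with
  | leaf x =>
    obtain rfl : y = x := by simpa [labels] using hy
    rfl
  | node l r =>
    obtain ⟨rfl, -⟩ | ⟨h1, h2⟩ := row_node_ne_zero h
    · exact absurd rfl hM
    exfalso
    -- Below a vertex carrying M every leaf word has at least one letter more than M, so none of
    -- them equals M.
    obtain ⟨N, hN, hN'⟩ : ∃ N, k y = posWord N ∧ M.length + 1 ≤ N.length := by
      rcases List.mem_append.1 hy with hy | hy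
      · exact exists_posWord_of_row_ne_zero (by simp) h1 hy
      · exact exists_posWord_of_row_ne_zero (by simp) h2 hy
    rw [hk] at hN
    rw [posWord_injective hN] at hN'
    omega

/-- Every vertex above the switch to a, b again passes on matching words aw, bw. Moving to a
nontrivial child as long as there is one ends at a caret. The pair of subtrees changes at each move,
hence the induction on the number of leaves. -/
theorem exists_hasCaret_of_row_node_ne_zero {l r : LTree X} {k : X → F2} {M : List (Fin 2)}
    (hl : l.row (Rα α) k (posWord (0 :: M)) ≠ 0) (hr : r.row (Rα α) k (posWord (1 :: M)) ≠ 0) :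
    ∃ x y L, (node l r).HasCaret x y ∧ k x = posWord (0 :: L) ∧ k y = posWord (1 :: L) := by
  induction hn : (node l r).labels.length using Nat.strong_induction_on generalizing l r M with
  | _ n ih =>
  subst hn
  have := List.length_pos_iff.2 l.labels_ne_nil
  have := List.length_pos_iff.2 r.labels_ne_nil
  have aux : ∀ {l r : LTree X} {N : List (Fin 2)}, N ≠ [] →
      (node l r).row (Rα α) k (posWord N) ≠ 0 →
      l.row (Rα α) k (posWord (0 :: N)) ≠ 0 ∧ r.row (Rα α) k (posWord (1 :: N)) ≠ 0 := by
    intro l r N hN h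
    obtain ⟨rfl, -⟩ | h := row_node_ne_zero h
    · exact absurd rfl hN
    · exact h
  cases l with
  | node l₁ l₂ =>
    obtain ⟨h1, h2⟩ := aux (by simp) hl
    obtain ⟨x, y, L, h, h'⟩ := ih _
        (by simp only [labels, List.length_append] at *; omega) h1 h2 rfl
    exact ⟨x, y, L, h.left, h'⟩
  | leaf x =>
    cases r with
    | node r₁ r₂ =>
      obtain ⟨h1, h2⟩ := aux (by simp) hr
      obtain ⟨x, y, L, h, h'⟩ := ih _
        (by simp only [labels, List.length_append] at *; omega) h1 h2 rfl
      exact ⟨x, y, L, h.right, h'⟩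
    | leaf y => exact ⟨x, y, M, .here, row_leaf_ne_zero hl, row_leaf_ne_zero hr⟩

/-- Follow the vertices carrying e towards a leaf that does not carry e: some vertex on the way must
pass on a, b instead, and above it there is a caret. -/
theorem exists_hasCaret_of_row_one_ne_zero {t : LTree X} {k : X → F2}
    (h : t.row (Rα α) k 1 ≠ 0) (hk : ∃ z ∈ t.labels, k z ≠ 1) :
    ∃ x y L, t.HasCaret x y ∧ k x = posWord (0 :: L) ∧ k y = posWord (1 :: L) := by
  induction t with
  | leaf x =>
    obtain ⟨z, hz, hz'⟩ := hk
    obtain rfl : z = x := by simpa [labels] using hz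
    exact absurd (row_leaf_ne_zero h) hz'
  | node l r hl hr =>
    obtain ⟨-, h1, h2⟩ | ⟨h1, h2⟩ := row_node_ne_zero (M := []) h
    · obtain ⟨z, hz, hz'⟩ := hk
      rcases List.mem_append.1 hz with hz | hz
      · obtain ⟨x, y, L, h, h'⟩ := hl h1 ⟨z, hz, hz'⟩
        exact ⟨x, y, L, h.left, h'⟩
      · obtain ⟨x, y, L, h, h'⟩ := hr h2 ⟨z, hz, hz'⟩
        exact ⟨x, y, L, h.right, h'⟩
    · exact exists_hasCaret_of_row_node_ne_zero h1 h2

/-- A leaf whose word starts with `a` is a left child; if the next leaf carries the matching word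
that starts with `b`, both form a caret. -/
theorem eq_leaf_or_exists_next {t : LTree X} {k : X → F2} {M L : List (Fin 2)}
    (h : t.row (Rα α) k (posWord M) ≠ 0) {x : X} (hx : x ∈ t.labels)
    (hk : k x = posWord (0 :: L)) :
    (t = leaf x ∧ M = 0 :: L) ∨
      ∃ y, [x, y] <:+: t.labels ∧ (k y = posWord (1 :: L) → t.HasCaret x y) := by
  induction t generalizing M with
  | leaf z =>
    obtain rfl : x = z := by simpa [labels] using hx
    exact .inl ⟨rfl, posWord_injective ((row_leaf_ne_zero h).symm.trans hk)⟩
  | node l r hl hr =>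
    right
    rcases List.mem_append.1 hx with hx | hx
    · have emb : (∃ y, [x, y] <:+: l.labels ∧ (k y = posWord (1 :: L) → l.HasCaret x y)) →
          ∃ y, [x, y] <:+: (node l r).labels ∧
            (k y = posWord (1 :: L) → (node l r).HasCaret x y) :=
        fun ⟨y, h1, h2⟩ => ⟨y, h1.trans (List.prefix_append _ _).isInfix, fun h => (h2 h).left⟩
      obtain ⟨-, h1, -⟩ | ⟨h1, h2⟩ := row_node_ne_zero h
      · obtain ⟨-, h0⟩ | h0 := hl h1 hx
        · simp at h0
        · exact emb h0
      · obtain ⟨rfl, h0⟩ | h0 := hl h1 hx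
        -- The left child is the leaf x itself, so the right child carries the word b·L at its root,
        -- and its first leaf y follows x.
        · obtain rfl : M = L := by simpa using h0
          obtain ⟨y, R, hR⟩ := List.exists_cons_of_ne_nil r.labels_ne_nil
          refine ⟨y, ⟨[], R, by simp [labels, hR]⟩, fun hy => ?_⟩
          -- If y carries the same word as the root of the right subtree, that subtree is the leaf
          -- y.
          rw [eq_leaf_of_row_ne_zero (by simp) h2 (by simp [hR]) hy]
          exact .here
        · exact emb h0
    · have emb : (∃ y, [x, y] <:+: r.labels ∧ (k y = posWord (1 :: L) → r.HasCaret x y)) →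
          ∃ y, [x, y] <:+: (node l r).labels ∧
            (k y = posWord (1 :: L) → (node l r).HasCaret x y) :=
        fun ⟨y, h1, h2⟩ => ⟨y, h1.trans (List.suffix_append _ _).isInfix, fun h => (h2 h).right⟩
      obtain ⟨-, -, h1⟩ | ⟨-, h1⟩ := row_node_ne_zero h
      · obtain ⟨-, h0⟩ | h0 := hr h1 hx
        · simp at h0
        · exact emb h0
      -- The root word of a right child starts with b, so x cannot be that child.
      · obtain ⟨-, h0⟩ | h0 := hr h1 hx
        · simp at h0
        · exact emb h0

/-- A switch to a, b would leave nonempty words on the leaves above it. So each of the inner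
vertices, one fewer than the leaves, contributes α. -/
theorem row_one_one (t : LTree X) :
    t.row (Rα α) (fun _ => 1) 1 = ((α : ℝ) : ℂ) ^ (t.labels.length - 1) := by
  classical
  induction t with
  | leaf x => rw [row_leaf, L2.δ_apply]; simp [labels]
  | node l r hl hr =>
    have hl0 := List.length_pos_iff.2 l.labels_ne_nil
    have hr0 := List.length_pos_iff.2 r.labels_ne_nil
    have h0 : l.row (Rα α) (fun _ => 1) a = 0 := by
      by_contra h
      obtain ⟨y, hy⟩ := List.exists_mem_of_ne_nil _ l.labels_ne_nil
      obtain ⟨N, hN, hN'⟩ := exists_posWord_of_row_ne_zero (M := [0]) (by simp)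
        (by rwa [posWord_zero_cons, posWord_nil, mul_one]) hy
      rw [posWord_eq_one_iff.1 hN.symm] at hN'
      simp at hN'
    rw [row_node_one, h0, hl, hr, zero_mul, mul_zero, add_zero, ← pow_add, ← pow_succ']
    congr 1
    simp only [labels, List.length_append]
    omega

end Rows

end LTree

open LTree

/-! ### Cancelling common carets -/

namespace LTree

/-- The tree with one caret with leaves `x`, `y` if `z = x`, and the trivial tree otherwise. -/
def caretAt {X : Type} [DecidableEq X] (x y z : X) : LTree X :=
  if z = x then node (leaf x) (leaf y) else leaf z

theorem bind_caretAt_of_notMem {X : Type} [DecidableEq X] {x : X} (y : X) {t : LTree X}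
    (h : x ∉ t.labels) : t.bind (caretAt x y) = t :=
  (bind_congr t _ leaf fun _ hz =>
    if_neg (ne_of_mem_of_not_mem hz h)).trans t.bind_leaf

/-- The collapsed caret becomes a leaf that keeps the label x, while y disappears. As labels are
distinct, x occurs nowhere else and regluing the caret affects only this leaf. -/
theorem HasCaret.exists_collapse {X : Type} [DecidableEq X] {x y : X} {t : LTree X}
    (h : t.HasCaret x y) (hn : t.labels.Nodup) :
    ∃ u : LTree X, u.bind (caretAt x y) = t ∧ t.labels.Perm (y :: u.labels) := by
  induction h with
  | here => exact ⟨leaf x, if_pos rfl, List.Perm.swap _ _ _⟩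
  | @left l r h ih =>
    simp only [labels, List.nodup_append'] at hn
    obtain ⟨u, hu, hp⟩ := ih hn.1
    refine ⟨node u r, ?_, hp.append_right _⟩
    rw [bind, hu, bind_caretAt_of_notMem y fun hx => hn.2.2 (h.infix.subset (by simp)) hx]
  | @right l r h ih =>
    simp only [labels, List.nodup_append'] at hn
    obtain ⟨u, hu, hp⟩ := ih hn.2.1
    refine ⟨node l u, ?_, (hp.append_left _).trans List.perm_middle⟩
    rw [bind, hu, bind_caretAt_of_notMem y fun hx => hn.2.2 hx (h.infix.subset (by simp))]

end LTree

namespace SForest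

theorem labels_perm {n : ℕ} (t : SForest 1 n) : (t.tree 0).labels.Perm (List.finRange n) := by
  rw [← leafLabels_one]; exact t.perm

theorem nodup_labels {n : ℕ} (t : SForest 1 n) : (t.tree 0).labels.Nodup :=
  t.labels_perm.nodup_iff.2 (List.nodup_finRange n)

theorem length_labels {n : ℕ} (t : SForest 1 n) : (t.tree 0).labels.length = n :=
  t.labels_perm.length_eq.trans List.length_finRange

theorem mem_labels {n : ℕ} (t : SForest 1 n) (x : Fin n) : x ∈ (t.tree 0).labels :=
  t.labels_perm.mem_iff.2 (List.mem_finRange x)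

theorem ext_one {n : ℕ} {t s : SForest 1 n} (h : t.tree 0 = s.tree 0) : t = s := by
  ext j : 2
  rwa [Subsingleton.elim j 0]

theorem pos {n : ℕ} (t : SForest 1 n) : 0 < n := by
  rw [← t.length_labels]
  exact List.length_pos_iff.2 (labels_ne_nil _)

/-- A caret of a symmetric tree can be removed. -/
theorem exists_collapse {m : ℕ} {x y : Fin (m + 1)} (t : SForest 1 (m + 1))
    (h : (t.tree 0).HasCaret x y) :
    ∃ t' : SForest 1 m, (t'.tree 0).bind (fun j => caretAt x y (y.succAbove j)) = t.tree 0 := by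
  obtain ⟨u, hu, hp⟩ := h.exists_collapse t.nodup_labels
  -- The labels other than y are exactly the values of `y.succAbove`.
  have hm : (y :: (List.finRange m).map y.succAbove).Perm (List.finRange (m + 1)) := by
    refine (List.perm_ext_iff_of_nodup ?_ (List.nodup_finRange _)).2 fun z => ?_
    · refine List.nodup_cons.2 ⟨?_, (List.nodup_finRange m).map Fin.succAbove_right_injective⟩
      simp [Fin.succAbove_ne]
    · obtain rfl | ⟨j, rfl⟩ := Fin.eq_self_or_eq_succAbove y z <;> simp
  have hl : u.labels.Perm ((List.finRange m).map y.succAbove) :=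
    (hp.symm.trans (t.labels_perm.trans hm.symm)).cons_inv
  have : Nonempty (Fin m) := by
    obtain ⟨z, hz⟩ := List.exists_mem_of_ne_nil _ u.labels_ne_nil
    obtain ⟨j, -⟩ := List.mem_map.1 (hl.mem_iff.1 hz)
    exact ⟨j⟩
  -- The map f closes the gap left by y; its value at y is irrelevant, since y no longer occurs.
  obtain ⟨f, hf⟩ := (Fin.succAbove_right_injective (p := y)).hasLeftInverse
  refine ⟨⟨fun _ => u.bind fun z => leaf (f z), ?_⟩, ?_⟩
  · have : (u.bind fun z => leaf (f z)).labels = u.labels.map f := by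
      rw [labels_bind, List.map_eq_flatMap]
      rfl
    simp only [List.finRange_succ, List.finRange_zero, List.map_nil, List.flatMap_cons,
      List.flatMap_nil, List.append_nil, this]
    refine (hl.map f).trans (.of_eq ?_)
    rw [List.map_map, hf.comp_eq_id, List.map_id]
  · change (u.bind fun z => leaf (f z)).bind _ = _
    rw [LTree.bind_assoc, ← hu]
    refine bind_congr u _ _ fun z hz => ?_
    obtain ⟨j, -, rfl⟩ := List.mem_map.1 (hl.mem_iff.1 hz)
    change caretAt x y (y.succAbove (f (y.succAbove j))) = _
    rw [hf]

/-- The i-th label is i + k mod n for a fixed k. The successor of x therefore does not depend on k,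
and is common to all affine trees; this is where T differs from V. -/
theorem IsAffine.val_next {n : ℕ} {t : SForest 1 n} (ht : t.IsAffine) {x y : Fin n}
    (h : [x, y] <:+: (t.tree 0).labels) : (y : ℕ) = (x + 1) % n := by
  rw [IsAffine, leafLabels_one] at ht
  obtain ⟨k, hk⟩ := ht.symm
  obtain ⟨A, B, hAB⟩ := h
  have hget : ∀ (i : ℕ) (hi : i < (t.tree 0).labels.length),
      ((t.tree 0).labels[i] : ℕ) = (i + k) % n := by
    intro i hi
    simp only [← hk, List.getElem_rotate, List.length_finRange, List.getElem_finRange,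
      Fin.val_cast]
  have hlen := congrArg List.length hAB
  simp only [List.length_append, List.length_cons, List.length_nil] at hlen
  have h1 := hget A.length (by omega)
  have h2 := hget (A.length + 1) (by omega)
  simp only [← hAB, List.append_assoc] at h1 h2
  simp at h1 h2
  rw [h1, h2, Nat.mod_add_mod]
  congr 1
  omega

end SForest

/-- The forest that reglues the caret depends only on x and y, so the same forest cancels from both
trees. -/
theorem ThompsonV.not_isReduced_of_hasCaret {n : ℕ} {t s : SForest 1 n} {x y : Fin n}
    (ht : (t.tree 0).HasCaret x y) (hs : (s.tree 0).HasCaret x y) :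
    ¬ ThompsonV.IsReduced t s := by
  cases n with
  | zero => exact x.elim0
  | succ m =>
    obtain ⟨t', ht'⟩ := t.exists_collapse ht
    obtain ⟨s', hs'⟩ := s.exists_collapse hs
    obtain ⟨p, hp⟩ := SForest.exists_comp_eq t' t ⟨_, ht'⟩
    -- Every label occurs in t', so t' and t determine all trees of p.
    have hpt : ∀ j, p.tree j = caretAt x y (y.succAbove j) := fun j => by
      refine eq_of_bind_eq (t := t'.tree 0) (q := fun j => caretAt x y (y.succAbove j)) ?_ j
        (t'.mem_labels j)
      rw [ht', ← hp]
      rfl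
    have hps : p.comp s' = s := SForest.ext_one <| by
      rw [← hs']
      exact bind_congr _ _ _ fun j _ => hpt j
    intro h
    refine h m t' s' (Nat.lt_succ_self m) ?_
    rw [← hp, ← hps, ThompsonV.frac_comp]

/-! ### The values of φ_α on reduced affine pairs -/

section Coefficients

variable {α : unitInterval}

/-- Two affine trees without a common caret have only the constant configuration in common. -/
theorem eq_one_of_row_ne_zero {n : ℕ} {t s : SForest 1 n} (ht : t.IsAffine) (hs : s.IsAffine)
    (h : ThompsonV.IsReduced t s) {k : Fin n → F2} (hkt : (t.tree 0).row (Rα α) k 1 ≠ 0)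
    (hks : (s.tree 0).row (Rα α) k 1 ≠ 0) : k = fun _ => 1 := by
  by_contra hk
  obtain ⟨z, hz⟩ := Function.ne_iff.1 hk
  obtain ⟨x, y, L, hc, hx, hy⟩ := exists_hasCaret_of_row_one_ne_zero hkt ⟨z, t.mem_labels z, hz⟩
  obtain ⟨-, h0⟩ | ⟨y', hi, hc'⟩ := eq_leaf_or_exists_next (M := []) hks (s.mem_labels x) hx
  · simp at h0
  -- Both y in t and y' in s follow x, hence both are x + 1 mod n.
  · obtain rfl : y = y' := Fin.ext ((ht.val_next hc.infix).trans (hs.val_next hi).symm)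
    exact ThompsonV.not_isReduced_of_hasCaret hc (hc' hy) h

theorem SForest.Φ_δ_apply {I : Type} (R : L2 I →ₗᵢ[ℂ] L2 (I × I)) {n : ℕ} (t : SForest 1 n)
    (i : I) (k : Fin n → I) :
    t.Φ R (L2.δ fun _ => i) k = (starRingEnd ℂ) ((t.tree 0).row R k i) := by
  have h := SForest.adj_Φ R t k
  have h' := congrArg (fun v : L2 (Fin 1 → I) => v fun _ => i) h
  simp only [L2.adj_apply, L2.tensPi_apply, Finset.univ_unique, Finset.prod_singleton] at h'
  change _ = (t.tree 0).row R k i at h'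
  rw [← h', inner_conj_symm, L2.inner_δ]

/-- A symmetric tree is itself a forest growing on the trivial tree, so the vacuum can be expanded
along any t. -/
theorem vacuum_eq {n : ℕ} (t : SForest 1 n) :
    vacuum α = JonesSpace.mk (Rα α) t (t.Φ (Rα α) (L2.δ fun _ => 1)) :=
  (congrArg (fun x : PreJones (Rα α) => (x : JonesSpace (Rα α)))
    (PreJones.mk_comp (R := Rα α) t (SForest.id 1) (L2.δ fun _ => 1))).symm

theorem φα_frac {n : ℕ} (t s : SForest 1 n) :
    φα α (.frac t s) =
      inner ℂ (t.Φ (Rα α) (L2.δ fun _ => 1)) (s.Φ (Rα α) (L2.δ fun _ => 1)) := by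
  rw [φα]
  -- The vacuum acted upon is expanded along s, so that t/s applies; the other one is then expanded
  -- along t.
  conv_lhs =>
    enter [3]
    rw [vacuum_eq s]
  rw [πα, jonesRep_frac, vacuum_eq t, JonesSpace.mk, JonesSpace.mk,
    UniformSpace.Completion.inner_coe, PreJones.inner_mk]

theorem φα_frac_of_isReduced {n : ℕ} {t s : SForest 1 n} (ht : t.IsAffine) (hs : s.IsAffine)
    (h : ThompsonV.IsReduced t s) : φα α (.frac t s) = ((α : ℝ) : ℂ) ^ (2 * n - 2) := by
  rw [φα_frac, lp.inner_eq_tsum, tsum_eq_single fun _ => 1]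
  · rw [SForest.Φ_δ_apply, SForest.Φ_δ_apply, row_one_one, row_one_one, t.length_labels,
      s.length_labels, ← Complex.ofReal_pow, Complex.conj_ofReal]
    simp only [RCLike.inner_apply, Complex.conj_ofReal]
    rw [Complex.ofReal_pow, ← pow_add]
    congr 1
    omega
  · intro k hk
    rw [SForest.Φ_δ_apply, SForest.Φ_δ_apply]
    by_contra h0
    refine hk (eq_one_of_row_ne_zero ht hs h (α := α) (fun e => h0 ?_) fun e => h0 ?_) <;>
      simp [e]

end Coefficients

/-! ### Positive definiteness -/

theorem isPositiveDefinite_φα (α : unitInterval) : IsPositiveDefinite (φα α) := by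
  intro n x
  -- By unitarity the matrix is the Gram matrix of the translates of the vacuum.
  have : (Matrix.of fun i j => φα α ((x i)⁻¹ * x j)) =
      Matrix.gram ℂ fun i => πα α (x i) (vacuum α) := by
    ext i j
    rw [Matrix.of_apply, Matrix.gram_apply, φα, ← (πα α (x i)).inner_map_map]
    change inner ℂ _ ((πα α (x i) * πα α ((x i)⁻¹ * x j)) (vacuum α)) = _
    rw [← map_mul, mul_inv_cancel_left]
  rw [this]
  exact Matrix.posSemidef_gram ℂ _

theorem IsPositiveDefinite.subgroup {G : Type*} [Group G] {φ : G → ℂ} (h : IsPositiveDefinite φ)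
    (H : Subgroup G) : IsPositiveDefinite fun g : H => φ g :=
  fun n x => h n fun i => x i

/-! ### Reduced affine representatives of the elements of T -/

open scoped List

theorem isRotated_flatMap {X Y : Type} {L M : List X} (h : L ~r M) (f : X → List Y) :
    L.flatMap f ~r M.flatMap f := by
  obtain ⟨k, rfl⟩ := h
  rw [List.rotate_eq_drop_append_take_mod]
  conv_lhs => rw [← List.take_append_drop (k % L.length) L]
  simp only [List.flatMap_append]
  exact List.isRotated_append

/-- If the concatenations of disjoint non-empty blocks are rotations of each other, the order of
the blocks is the same up to a rotation. -/
theorem isRotated_of_flatMap {X Y : Type} {L M : List X} {f : X → List Y} (hf : ∀ x, f x ≠ [])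
    (hn : ∀ x, (f x).Nodup) (hd : ∀ x x', x ≠ x' → (f x).Disjoint (f x'))
    (h : L.flatMap f ~r M.flatMap f) : L ~r M := by
  classical
  choose head tail hht using fun x => List.exists_cons_of_ne_nil (hf x)
  -- The map g sends the first entry of each block to the name of the block and erases all other
  -- entries, so it turns concatenated blocks back into the list of their names.
  let g : Y → List X := fun y => if h : ∃ x, head x = y then [h.choose] else []
  have key : ∀ x, (f x).flatMap g = [x] := by
    intro x
    have h1 : g (head x) = [x] := by
      have hx : ∃ x', head x' = head x := ⟨x, rfl⟩
      simp only [g, dif_pos hx]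
      congr 1
      by_contra hne
      refine hd _ _ hne (a := head x) ?_ (by simp [hht])
      rw [hht, hx.choose_spec]
      exact List.mem_cons_self
    have h2 : ∀ y ∈ tail x, g y = [] := by
      intro y hy
      refine dif_neg ?_
      rintro ⟨x', rfl⟩
      by_cases hne : x' = x
      · subst hne
        have := hn x'
        rw [hht, List.nodup_cons] at this
        exact this.1 hy
      · exact hd _ _ hne (a := head x') (by rw [hht]; exact List.mem_cons_self)
          (by rw [hht]; exact List.mem_cons_of_mem _ hy)
    rw [hht, List.flatMap_cons, h1, List.flatMap_eq_nil_iff.2 h2, List.append_nil]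
  have := isRotated_flatMap h g
  simpa only [List.flatMap_assoc, key, List.flatMap_singleton'] using this

/-- Composing with p replaces each label by a block, the labels of a tree of p; these blocks are
disjoint and nonempty, so their cyclic order can be recovered. -/
theorem SForest.isRotated_of_comp {n m : ℕ} (p : SForest n m) {t s : SForest 1 n}
    (h : (p.comp t).leafLabels ~r (p.comp s).leafLabels) : t.leafLabels ~r s.leafLabels := by
  rw [leafLabels_comp, leafLabels_comp] at h
  have hp : ((List.finRange n).flatMap fun j => (p.tree j).labels).Nodup :=
    p.perm.nodup_iff.2 (List.nodup_finRange m)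
  rw [List.nodup_flatMap] at hp
  refine isRotated_of_flatMap (fun x => labels_ne_nil _) (fun x => hp.1 x (List.mem_finRange x))
    (fun x x' hne => ?_) h
  have : Std.Symm (Function.onFun List.Disjoint fun j => (p.tree j).labels) :=
    ⟨fun _ _ h => List.Disjoint.symm h⟩
  exact hp.2.forall (List.mem_finRange x) (List.mem_finRange x') hne

theorem SForest.isRotated_comp {n m : ℕ} (p : SForest n m) {t s : SForest 1 n}
    (h : t.leafLabels ~r s.leafLabels) : (p.comp t).leafLabels ~r (p.comp s).leafLabels := by
  rw [leafLabels_comp, leafLabels_comp]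
  exact isRotated_flatMap h _

/-- The leaves of a symmetric tree can be renumbered in order. -/
theorem SForest.exists_comp_leafLabels_eq {n : ℕ} (s : SForest 1 n) :
    ∃ p : SForest n n, (p.comp s).leafLabels = List.finRange n := by
  obtain ⟨v, hv, hv'⟩ := exists_relabel (s.tree 0) (List.finRange n) (by simp [s.length_labels])
  obtain ⟨p, hp⟩ := exists_comp_eq s ⟨fun _ => v, by simp [List.finRange_succ, hv]⟩
    (exists_bind_eq _ s.nodup_labels _ ⟨_, hv'.symm⟩)
  exact ⟨p, by rw [hp, leafLabels_one]; exact hv⟩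

/-- Equality in a direct limit means agreement at a common later index; here that index is a common
expansion of t and t'. -/
theorem ThompsonV.exists_comp_of_frac_eq {n m : ℕ} {t s : SForest 1 n} {t' s' : SForest 1 m}
    (h : frac t s = frac t' s') : ∃ (N : ℕ) (p : SForest n N) (q : SForest m N),
      p.comp t = q.comp t' ∧ p.comp s = q.comp s' := by
  obtain ⟨⟨N, u⟩, hx, hy, he⟩ := Quotient.exact h
  exact ⟨N, STree.growth hx, STree.growth hy,
    (STree.growth_comp hx).trans (STree.growth_comp hy).symm, he⟩

/-- Reducedness refers to all symmetric pairs, so a smallest such pair is taken, affine or not. A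
common expansion with an affine pair shows that its two label lists are rotations of each other;
renumbering the leaves then makes both trees affine. -/
theorem exists_isReduced {g : ThompsonV} (hg : g ∈ ThompsonT) : ∃ (n : ℕ) (t s : SForest 1 n),
    t.IsAffine ∧ s.IsAffine ∧ ThompsonV.IsReduced t s ∧ g = .frac t s := by
  classical
  have hex : ∃ n, ∃ t s : SForest 1 n, g = .frac t s := g.exists_frac
  obtain ⟨t, s, hts⟩ := Nat.find_spec hex
  obtain ⟨m, t', s', ht', hs', h'⟩ := hg
  obtain ⟨N, p, q, hpt, hps⟩ := ThompsonV.exists_comp_of_frac_eq (hts.symm.trans h')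
  have hr : t.leafLabels ~r s.leafLabels := by
    refine p.isRotated_of_comp ?_
    rw [hpt, hps]
    exact q.isRotated_comp (ht'.trans hs'.symm)
  obtain ⟨σ, hσ⟩ := s.exists_comp_leafLabels_eq
  refine ⟨_, σ.comp t, σ.comp s, ?_, ?_, ?_, ?_⟩
  · rw [SForest.IsAffine, ← hσ]
    exact σ.isRotated_comp hr
  · rw [SForest.IsAffine, hσ]
  · intro k a b hk hab
    rw [ThompsonV.frac_comp, ← hts] at hab
    exact Nat.find_min hex hk ⟨a, b, hab.symm⟩
  · rw [ThompsonV.frac_comp]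
    exact hts

/-! ### Finiteness and countability -/

theorem LTree.finite_length_le (X : Type) [Finite X] (n : ℕ) :
    {t : LTree X | t.labels.length ≤ n}.Finite := by
  induction n with
  | zero =>
    refine Set.finite_empty.subset fun t ht => ?_
    have := List.length_pos_iff.2 t.labels_ne_nil
    have : t.labels.length ≤ 0 := ht
    omega
  | succ n ih =>
    refine ((Set.finite_range leaf).union (Set.Finite.image2 node ih ih)).subset ?_
    rintro (x | ⟨l, r⟩) ht
    · exact .inl ⟨x, rfl⟩
    · have hl := List.length_pos_iff.2 l.labels_ne_nil
      have hr := List.length_pos_iff.2 r.labels_ne_nil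
      change (l.labels ++ r.labels).length ≤ n + 1 at ht
      rw [List.length_append] at ht
      exact .inr ⟨l, (by omega : l.labels.length ≤ n), r, (by omega : r.labels.length ≤ n), rfl⟩

instance (n : ℕ) : Finite (SForest 1 n) := by
  have := (LTree.finite_length_le (Fin n) n).to_subtype
  refine Finite.of_injective
    (fun t : SForest 1 n => (⟨t.tree 0, t.length_labels.le⟩ :
      {t : LTree (Fin n) | t.labels.length ≤ n})) ?_
  exact fun t s h => SForest.ext_one (congrArg Subtype.val h)

instance : Countable ThompsonV := by
  refine Function.Surjective.countable
    (f := fun x : Σ n, SForest 1 n × SForest 1 n => ThompsonV.frac x.2.1 x.2.2) fun g => ?_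
  obtain ⟨n, t, s, rfl⟩ := g.exists_frac
  exact ⟨⟨n, t, s⟩, rfl⟩

theorem finite_setOf_frac (N : ℕ) :
    {g : ThompsonV | ∃ n < N, ∃ t s : SForest 1 n, g = .frac t s}.Finite := by
  refine (Set.finite_range fun x : Σ n : Fin N, SForest 1 n × SForest 1 n =>
    ThompsonV.frac x.2.1 x.2.2).subset ?_
  rintro g ⟨n, hn, t, s, rfl⟩
  exact ⟨⟨⟨n, hn⟩, t, s⟩, rfl⟩

/-! ### Behaviour at infinity and as α tends to 1 -/

theorem tendsto_φα_cofinite {α : unitInterval} (hα : α < 1) :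
    Filter.Tendsto (fun g : ThompsonT => φα α g) Filter.cofinite (nhds 0) := by
  have hα' : |(α : ℝ)| < 1 := by rw [abs_of_nonneg α.2.1]; exact hα
  rw [Metric.tendsto_nhds]
  intro ε hε
  obtain ⟨N, hN⟩ := Filter.eventually_atTop.1
    ((tendsto_pow_atTop_nhds_zero_of_abs_lt_one hα').eventually_lt_const hε)
  rw [Filter.eventually_cofinite]
  refine Set.Finite.subset ((finite_setOf_frac (N + 1)).preimage Subtype.val_injective.injOn) ?_
  rintro ⟨g, hg⟩ hgε
  obtain ⟨n, t, s, ht, hs, hr, rfl⟩ := exists_isReduced hg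
  refine ⟨n, ?_, t, s, rfl⟩
  by_contra hn
  refine hgε ?_
  -- For n ≥ N + 1 the exponent is at least 2N, hence at least N.
  have := hN (2 * n - 2) (by have := t.pos; omega)
  rw [dist_zero_right, φα_frac_of_isReduced ht hs hr, norm_pow, Complex.norm_real, Real.norm_eq_abs,
    abs_of_nonneg α.2.1]
  exact this

/-- The reduced pair does not depend on α, so φ_α(g) is a fixed power of α, continuous with value 1
at α = 1. -/
theorem tendsto_φα_nhds_one (g : ThompsonT) :
    Filter.Tendsto (fun α : unitInterval => φα α g) (nhds 1) (nhds 1) := by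
  obtain ⟨n, t, s, ht, hs, hr, hg⟩ := exists_isReduced g.2
  simp only [hg, φα_frac_of_isReduced ht hs hr]
  have : Continuous fun α : unitInterval => ((α : ℝ) : ℂ) ^ (2 * n - 2) := by fun_prop
  simpa using this.tendsto 1

theorem hasHaagerupProperty_thompsonT : HasHaagerupProperty ThompsonT := by
  -- The parameters 1 - 1/(n+1) start at 0, stay below 1 and tend to 1.
  let α : ℕ → unitInterval := fun n => unitInterval.symm
    ⟨1 / ((n : ℝ) + 1), by positivity, by rw [div_le_one (by positivity)]; simp⟩
  have hα : ∀ n, ((α n : unitInterval) : ℝ) = 1 - 1 / ((n : ℝ) + 1) := fun n => rfl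
  refine ⟨inferInstance, fun n g => φα (α n) g,
    fun n => (isPositiveDefinite_φα _).subgroup ThompsonT, fun n => tendsto_φα_cofinite ?_,
    fun g => (tendsto_φα_nhds_one g).comp ?_⟩
  · rw [← Subtype.coe_lt_coe, hα, Set.Icc.coe_one, sub_lt_self_iff]
    positivity
  · rw [tendsto_subtype_rng]
    simpa [hα] using (tendsto_one_div_add_atTop_nhds_zero_nat (𝕜 := ℝ)).const_sub 1

end Thompson

theorem mainTheorem2 :
    (∀ α : unitInterval, Thompson.IsPositiveDefinite (Thompson.φα α)) ∧
    (∀ g ∈ Thompson.ThompsonT, ∃ (n : ℕ) (t s : Thompson.SForest 1 n),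
      t.IsAffine ∧ s.IsAffine ∧ Thompson.ThompsonV.IsReduced t s ∧
        g = Thompson.ThompsonV.frac t s) ∧
    (∀ (α : unitInterval) (n : ℕ) (t s : Thompson.SForest 1 n),
      t.IsAffine → s.IsAffine → Thompson.ThompsonV.IsReduced t s →
        Thompson.φα α (Thompson.ThompsonV.frac t s) = ((α : ℝ) : ℂ) ^ (2 * n - 2)) ∧
    (∀ α : unitInterval, α < 1 →
      Filter.Tendsto (fun g : Thompson.ThompsonT => Thompson.φα α g) Filter.cofinite (nhds 0)) ∧
    (∀ g : Thompson.ThompsonT,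
      Filter.Tendsto (fun α : unitInterval => Thompson.φα α g)
        (nhdsWithin 1 (Set.Iio 1)) (nhds 1)) ∧
    Thompson.HasHaagerupProperty Thompson.ThompsonT :=
  ⟨Thompson.isPositiveDefinite_φα, fun _ => Thompson.exists_isReduced,
    fun _ _ _ _ => Thompson.φα_frac_of_isReduced, fun _ => Thompson.tendsto_φα_cofinite,
    fun g => (Thompson.tendsto_φα_nhds_one g).mono_left nhdsWithin_le_nhds,
    Thompson.hasHaagerupProperty_thompsonT⟩
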